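/- Fix $-1<w<1$. For $\mathbf S=(\Sigma_+,\bar\Sigma,\tilde\Sigma^2,\check\Sigma^2,\Omega_k,v^2)\in\mathbb R^6$ (the squares $\tilde\Sigma^2,\check\Sigma^2,v^2$ are treated as independent variables) put $$\Sigma^2=\Sigma_+^2+\bar\Sigma^2+\tilde\Sigma^2+\check\Sigma^2,\quad \Omega=1-\Sigma^2-\Omega_k,\quad G_\pm=1\pm w v^2,\quad q=2\Sigma^2+\tfrac12G_+^{-1}[1+3w+(1-w)v^2]\Omega .$$ The tilted Bianchi type II perfect fluid models with equation of state $p=w\rho$ are described by the system ($'=d/d\tau$) $$\begin{aligned} \Sigma_+'&=-(2-q)\Sigma_+-3\check\Sigma^2+4\Omega_k+\tfrac12(1+w)G_+^{-1}v^2\Omega,\\ \bar\Sigma'&=-(2-q)\bar\Sigma-2\sqrt3\,\tilde\Sigma^2+\sqrt3\,\check\Sigma^2+\tfrac{\sqrt3}{2}(1+w)G_+^{-1}v^2\Omega,\\ (\tilde\Sigma^2)'&=-2(2-q-2\sqrt3\,\bar\Sigma)\tilde\Sigma^2,\\ (\check\Sigma^2)'&=-2(2-q-3\Sigma_++\sqrt3\,\bar\Sigma)\check\Sigma^2,\\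 \Omega_k'&=2(q-4\Sigma_+)\Omega_k,\\ (v^2)'&=2G_-^{-1}(1-v^2)(3w-1-\Sigma_+-\sqrt3\,\bar\Sigma)v^2, \end{aligned}$$ with the constraint $4\check\Sigma^2\Omega_k-(1+w)^2G_+^{-2}v^2\Omega^2=0$. Let $\mathcal S_{\mathrm{Gen}}$ be the set of all $\mathbf S$ that satisfy the constraint, $\tilde\Sigma^2,\check\Sigma^2,\Omega_k,v^2,\Omega\ge0$, $v^2\le1$ and $(1-v^2)\,v^2\,\tilde\Sigma^2\,\check\Sigma^2\,\Omega\,\Omega_k\neq0$. **Theorem.** Let $\mathbf x\in\mathcal S_{\mathrm{Gen}}$. There is a solution of the system on $[0,\infty)$ starting at $\mathbf x$, and every such solution stays in $\mathcal S_{\mathrm{Gen}}$ and has the following $\omega$-limit set $\omega(\mathbf x)$: - $\omega(\mathbf x)=\{\mathrm F\}$ if $-1<w\le-\frac13$, where $\mathrm F=(0,0,0,0,0,0)$ (flat Friedmann); - $\omega(\mathbf x)=\{\mathrm{CS}\}$ if $-\frac13<w\le\frac37$, where $\mathrm{CS}=\left(\frac{3w+1}{8},0,0,0,\frac{3}{64}(3w+1)(1-w),0\right)$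 (Collins–Stewart); - $\omega(\mathbf x)=\{\mathrm H\}$ if $\frac37<w<\frac59$, where $\mathrm H=\left(\frac{3w+1}{8},\frac{\sqrt3}{8}(7w-3),0,\frac{3(1-w)(11w+1)(7w-3)}{16(17w-1)},\frac{3(1-w)(5w+1)(3w-1)}{4(17w-1)},\frac{(3w-1)(7w-3)}{(11w+1)(5w+1)}\right)$ (Hewitt); - $\omega(\mathbf x)=\{\mathrm{HL}(b)\}$ for some $b\in(0,1)$ depending on $\mathbf x$ if $w=\frac59$, where $\mathrm{HL}(b)=\left(\frac13,\frac{1}{3\sqrt3},\frac{4}{27}b,\frac{4(4b+1)(8-3b)}{513},\frac{(2b+1)(17-8b)}{171},\frac{3(4b+1)(2b+1)}{(17-8b)(8-3b)}\right)$, that is, the $\omega$-limit set is a single point of the line $\mathrm{HL}=\{\mathrm{HL}(b):0<b<1\}$ of fixed points; - $\omega(\mathbf x)=\{\mathrm{Het}\}$ if $\frac59<w<1$, where $\mathrm{Het}=\left(\frac13,\frac{1}{3\sqrt3},\frac{4}{27},\frac{100}{513},\frac{3}{19},1\right)$ (extremely tilted). -/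

import Mathlib

namespace TiltedBianchiII

noncomputable section

/-- State vectors `(Σ₊, Σ̄, Σ̃², Σ̌², Ω_k, v²)`.  The squares are themselves the coordinates.
Only the topology and the differentiable structure of the space are used. -/
abbrev State : Type := Fin 6 → ℝ

/-- `Σ₊` -/
abbrev sigPlus (S : State) : ℝ := S 0
/-- `Σ̄` -/
abbrev sigBar (S : State) : ℝ := S 1
/-- `Σ̃²` -/
abbrev sigTildeSq (S : State) : ℝ := S 2
/-- `Σ̌²` -/
abbrev sigCheckSq (S : State) : ℝ := S 3
/-- `Ω_k` -/
abbrev omK (S : State) : ℝ := S 4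
/-- `v²` -/
abbrev vSq (S : State) : ℝ := S 5

/-- `Σ² = Σ₊² + Σ̄² + Σ̃² + Σ̌²` -/
def sigSq (S : State) : ℝ := sigPlus S ^ 2 + sigBar S ^ 2 + sigTildeSq S + sigCheckSq S

/-- The density parameter, `Ω = 1 - Σ² - Ω_k` (Gauss constraint). -/
def om (S : State) : ℝ := 1 - sigSq S - omK S

/-- `G₊ = 1 + w v²` -/
def gPlus (w : ℝ) (S : State) : ℝ := 1 + w * vSq S

/-- `G₋ = 1 - w v²` -/
def gMinus (w : ℝ) (S : State) : ℝ := 1 - w * vSq S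

/-- The deceleration parameter `q`. -/
def decel (w : ℝ) (S : State) : ℝ :=
  2 * sigSq S + (1 / 2) * (gPlus w S)⁻¹ * (1 + 3 * w + (1 - w) * vSq S) * om S

/-- The right-hand side of the evolution equations (derivative with respect to `τ`). -/
def field (w : ℝ) (S : State) : State :=
  ![-(2 - decel w S) * sigPlus S - 3 * sigCheckSq S + 4 * omK S
      + (1 / 2) * (1 + w) * (gPlus w S)⁻¹ * vSq S * om S,
    -(2 - decel w S) * sigBar S - 2 * √3 * sigTildeSq S + √3 * sigCheckSq S
      + (√3 / 2) * (1 + w) * (gPlus w S)⁻¹ * vSq S * om S,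
    -2 * (2 - decel w S - 2 * √3 * sigBar S) * sigTildeSq S,
    -2 * (2 - decel w S - 3 * sigPlus S + √3 * sigBar S) * sigCheckSq S,
    2 * (decel w S - 4 * sigPlus S) * omK S,
    2 * (gMinus w S)⁻¹ * (1 - vSq S) * (3 * w - 1 - sigPlus S - √3 * sigBar S) * vSq S]

/-- The Codazzi constraint function `f(S)`. -/
def codazzi (w : ℝ) (S : State) : ℝ :=
  4 * sigCheckSq S * omK S - (1 + w) ^ 2 * (gPlus w S)⁻¹ ^ 2 * vSq S * om S ^ 2

/-- The state space: the constraint `f(S) = 0` holds, the coordinates that stand for squares and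
`Ω_k` are nonnegative, `v² ≤ 1`, and `Ω ≥ 0`. -/
def stateSpace (w : ℝ) : Set State :=
  {S | codazzi w S = 0 ∧ 0 ≤ sigTildeSq S ∧ 0 ≤ sigCheckSq S ∧ 0 ≤ omK S ∧
    0 ≤ vSq S ∧ vSq S ≤ 1 ∧ 0 ≤ om S}

/-- The general tilted type II state space `S_Gen`. -/
def sGen (w : ℝ) : Set State :=
  {S | S ∈ stateSpace w ∧
    (1 - vSq S) * vSq S * sigTildeSq S * sigCheckSq S * om S * omK S ≠ 0}

/-- `γ` is a solution of the evolution equations for all `τ ≥ 0` with initial state `x`;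
values of `γ` at `τ < 0` are irrelevant. -/
def IsFutureOrbit (w : ℝ) (x : State) (γ : ℝ → State) : Prop :=
  γ 0 = x ∧ IsIntegralCurveOn γ (fun _ => field w) (Set.Ici 0)

/-- The ω-limit set of a curve: all limits of `γ (τₙ)` for sequences `τₙ → ∞`. -/
def omegaSet (γ : ℝ → State) : Set State :=
  omegaLimit Filter.atTop (fun (τ : ℝ) (c : ℝ → State) => c τ) {γ}

/-- The flat Friedmann point `F`. -/
def ptF : State := ![0, 0, 0, 0, 0, 0]

/-- The Collins–Stewart point `CS`. -/
def ptCS (w : ℝ) : State :=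
  ![(3 * w + 1) / 8, 0, 0, 0, 3 / 64 * (3 * w + 1) * (1 - w), 0]

/-- Hewitt's point `H`. -/
def ptH (w : ℝ) : State :=
  ![(3 * w + 1) / 8,
    √3 / 8 * (7 * w - 3),
    0,
    3 * (1 - w) * (11 * w + 1) * (7 * w - 3) / (16 * (17 * w - 1)),
    3 * (1 - w) * (5 * w + 1) * (3 * w - 1) / (4 * (17 * w - 1)),
    (3 * w - 1) * (7 * w - 3) / ((11 * w + 1) * (5 * w + 1))]

/-- The point with parameter `b` on the line of fixed points `HL`. -/
def ptHL (b : ℝ) : State :=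
  ![1 / 3,
    1 / (3 * √3),
    4 / 27 * b,
    4 * (4 * b + 1) * (8 - 3 * b) / 513,
    (2 * b + 1) * (17 - 8 * b) / 171,
    3 * (4 * b + 1) * (2 * b + 1) / ((17 - 8 * b) * (8 - 3 * b))]

/-- The extremely tilted point `Het`. -/
def ptHet : State := ![1 / 3, 1 / (3 * √3), 4 / 27, 100 / 513, 3 / 19, 1]

end

end TiltedBianchiII

/-!
For every range of `w`, a product of powers of `Σ̃²`, `Σ̌²`, `Ω_k` and
`Ω G₊⁻¹ (1 - v²)^((1 - w) / 2)`, divided by a power of `1 - ⟨σ, σ₀⟩`, where `σ = (Σ₊, Σ̄)` and `σ₀`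
is the value of `σ` at the expected limit, increases along the flow: `1 - ⟨σ, σ₀⟩` times its
logarithmic derivative is a positive definite form in `σ - σ₀` plus a nonnegative remainder.
By LaSalle's principle all limit points have `σ = σ₀` and remainder zero, and by Barbalat's lemma
`σ' = 0` there as well. Together with the Gauss and Codazzi constraints, and with the positivity of
those factors that carry a positive exponent, these equations leave a single point.

For `w = 5/9` they leave the points of the line `HL`, but then two of these functions, Hewitt's and
the one of the extremely tilted point, are monotone, so that each takes a single value on the limit
set. Their ratio is strictly decreasing along `HL`, which singles out one value of `b`.
-/

namespace TiltedBianchiII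

open Filter Set Topology

section GlobalSolutions

variable {E : Type*} [NormedAddCommGroup E] [NormedSpace ℝ E] {F : E → E} {K M : NNReal}

theorem exists_isIntegralCurveOn_Icc [CompleteSpace E] (hK : LipschitzWith K F)
    (hM : ∀ y, ‖F y‖ ≤ M) (x : E) (n : ℕ) :
    ∃ γ : ℝ → E, γ 0 = x ∧ IsIntegralCurveOn γ (fun _ => F) (Icc 0 ((n : ℝ) + 1)) := by
  have h0 : (0 : ℝ) ∈ Icc (0 : ℝ) (n + 1) := ⟨le_rfl, by positivity⟩
  have hpl : IsPicardLindelof (fun _ : ℝ => F) (tmin := 0) (tmax := (n : ℝ) + 1)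
      ⟨0, h0⟩ x (M * (n + 1)) 0 M K :=
    { lipschitzOnWith := fun _ _ => hK.lipschitzOnWith
      continuousOn := fun _ _ => continuousOn_const
      norm_le := fun _ _ y _ => hM y
      mul_max_le := by simp [max_eq_left h0.2] }
  exact hpl.exists_eq_forall_mem_Icc_hasDerivWithinAt₀

theorem eqOn_Icc_of_isIntegralCurveOn (hK : LipschitzWith K F) {γ₁ γ₂ : ℝ → E} {a b : ℝ}
    (h₁ : IsIntegralCurveOn γ₁ (fun _ => F) (Icc a b))
    (h₂ : IsIntegralCurveOn γ₂ (fun _ => F) (Icc a b)) (ha : γ₁ a = γ₂ a) :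
    EqOn γ₁ γ₂ (Icc a b) := by
  have right_deriv {γ : ℝ → E} (h : IsIntegralCurveOn γ (fun _ => F) (Icc a b)) (t : ℝ)
      (ht : t ∈ Ico a b) : HasDerivWithinAt γ (F (γ t)) (Ici t) t :=
    (h t ⟨ht.1, ht.2.le⟩).mono_of_mem_nhdsWithin
      (mem_of_superset (Icc_mem_nhdsGE ht.2) (Icc_subset_Icc_left ht.1))
  exact ODE_solution_unique (fun _ => hK) (fun t ht => (h₁ t ht).continuousWithinAt)
    (right_deriv h₁) (fun t ht => (h₂ t ht).continuousWithinAt) (right_deriv h₂) ha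

theorem exists_isIntegralCurveOn_Ici [CompleteSpace E] (hK : LipschitzWith K F)
    (hM : ∀ y, ‖F y‖ ≤ M) (x : E) :
    ∃ γ : ℝ → E, γ 0 = x ∧ IsIntegralCurveOn γ (fun _ => F) (Ici 0) := by
  choose c hc0 hc using exists_isIntegralCurveOn_Icc hK hM x
  have hmono : ∀ {m n : ℕ}, m ≤ n → EqOn (c m) (c n) (Icc 0 ((m : ℝ) + 1)) := by
    intro m n hmn
    have hsub : Icc (0 : ℝ) (m + 1) ⊆ Icc 0 (n + 1) := Icc_subset_Icc_right (by gcongr)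
    exact eqOn_Icc_of_isIntegralCurveOn hK (hc m) ((hc n).mono hsub) (by rw [hc0, hc0])
  refine ⟨fun t => c ⌊t⌋₊ t, by simp [hc0], fun t ht => ?_⟩
  have hlocal : Ici (0 : ℝ) ∩ Iio ((⌊t⌋₊ : ℝ) + 1) ∈ 𝓝[Ici 0] t :=
    inter_mem_nhdsWithin _ (Iio_mem_nhds (Nat.lt_floor_add_one t))
  have hEq : ∀ s ∈ Ici (0 : ℝ) ∩ Iio ((⌊t⌋₊ : ℝ) + 1), c ⌊s⌋₊ s = c ⌊t⌋₊ s := by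
    rintro s ⟨hs0, hs1⟩
    have hle : ⌊s⌋₊ ≤ ⌊t⌋₊ := Nat.lt_succ_iff.1 ((Nat.floor_lt hs0).2 (by exact_mod_cast hs1))
    exact hmono hle ⟨hs0, (Nat.lt_floor_add_one s).le⟩
  have hderiv : HasDerivWithinAt (c ⌊t⌋₊) (F (c ⌊t⌋₊ t)) (Ici 0) t :=
    (hc _ t ⟨ht, (Nat.lt_floor_add_one t).le⟩).mono_of_mem_nhdsWithin
      (mem_of_superset hlocal fun s hs => ⟨hs.1, (mem_Iio.1 hs.2).le⟩)
  exact hderiv.congr_of_eventuallyEq (mem_of_superset hlocal hEq) rfl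

end GlobalSolutions

theorem exists_lipschitzWith_bounded_extension {α ι : Type*} [PseudoMetricSpace α] [Fintype ι]
    {f : α → ι → ℝ} {s : Set α} {K M : NNReal} (hK : LipschitzOnWith K f s)
    (hM : ∀ x ∈ s, ‖f x‖ ≤ M) :
    ∃ g : α → ι → ℝ, LipschitzWith K g ∧ (∀ x, ‖g x‖ ≤ M) ∧ EqOn f g s := by
  obtain ⟨g, hg, hfg⟩ := hK.extend_pi
  have hcoord {i : ι} : LipschitzWith K fun x => g x i :=
    one_mul K ▸ (LipschitzWith.eval i).comp hg
  refine ⟨fun x i => max (-M) (min (g x i) M), ?_, ?_, ?_⟩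
  · exact LipschitzWith.of_dist_le_mul fun x y => (dist_pi_le_iff (by positivity)).2 fun i =>
      ((hcoord.min_const (M : ℝ)).const_max (-M : ℝ)).dist_le_mul x y
  · intro x
    refine (pi_norm_le_iff_of_nonneg M.coe_nonneg).2 fun i => ?_
    rw [Real.norm_eq_abs, abs_le]
    exact ⟨le_max_left _ _, max_le (by linarith [M.coe_nonneg]) (min_le_right _ _)⟩
  · intro x hx
    funext i
    have hi := abs_le.1 ((norm_le_pi_norm (f x) i).trans (hM x hx))
    rw [hfg hx] at hi ⊢
    simp only [min_eq_left hi.2, max_eq_right hi.1]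

/-- Barbalat's lemma. -/
theorem tendsto_deriv_zero_of_tendsto {f g : ℝ → ℝ} {c : ℝ}
    (hf : ∀ t ∈ Ici (0 : ℝ), HasDerivWithinAt f (g t) (Ici 0) t)
    (hg : UniformContinuousOn g (Ici 0)) (hc : Tendsto f atTop (𝓝 c)) :
    Tendsto g atTop (𝓝 0) := by
  rw [Metric.tendsto_atTop]
  intro ε hε
  obtain ⟨δ, hδ, hgδ⟩ := Metric.uniformContinuousOn_iff.1 hg (ε / 2) (by positivity)
  obtain ⟨N, hN⟩ := Metric.tendsto_atTop.1 hc (ε / 4 * (δ / 2)) (by positivity)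
  refine ⟨max N 0, fun t ht => ?_⟩
  have ht0 : 0 ≤ t := (le_max_right _ _).trans ht
  have htN : N ≤ t := (le_max_left _ _).trans ht
  obtain ⟨s, hs, hslope⟩ := exists_hasDerivAt_eq_slope f g (show t < t + δ / 2 by linarith)
    (fun r hr => ((hf r (ht0.trans hr.1)).continuousWithinAt).mono fun u hu => ht0.trans hu.1)
    (fun r hr => (hf r (ht0.trans hr.1.le)).hasDerivAt (Ici_mem_nhds (ht0.trans_lt hr.1)))
  have hincr : |f (t + δ / 2) - f t| < ε / 2 * (δ / 2) := by
    have h₁ := abs_lt.1 (hN t htN)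
    have h₂ := abs_lt.1 (hN (t + δ / 2) (by linarith))
    exact abs_lt.2 ⟨by linarith, by linarith⟩
  have hgs : |g s| < ε / 2 := by
    rw [hslope, add_sub_cancel_left, abs_div, abs_of_pos (half_pos hδ)]
    exact (div_lt_iff₀ (half_pos hδ)).2 hincr
  have hgts : |g s - g t| < ε / 2 := hgδ s (ht0.trans hs.1.le) t ht0 <| by
    rw [Real.dist_eq, abs_of_pos (by linarith [hs.1])]
    linarith [hs.2]
  rw [Real.dist_eq, sub_zero]
  linarith [abs_sub_abs_le_abs_sub (g t) (g s), abs_sub_comm (g t) (g s)]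

theorem monotoneOn_Ici_of_hasDerivWithinAt_nonneg {f g : ℝ → ℝ} {a : ℝ}
    (hf : ∀ t ∈ Ici a, HasDerivWithinAt f (g t) (Ici a) t) (hg : ∀ t ∈ Ici a, 0 ≤ g t) :
    MonotoneOn f (Ici a) :=
  monotoneOn_of_hasDerivWithinAt_nonneg (convex_Ici a) (fun t ht => (hf t ht).continuousWithinAt)
    (fun t ht => (hf t (interior_subset ht)).mono interior_subset)
    fun t ht => hg t (interior_subset ht)

theorem exists_tendsto_atTop_of_monotoneOn_Ici {f : ℝ → ℝ} {a B : ℝ} (hf : MonotoneOn f (Ici a))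
    (hB : ∀ t ∈ Ici a, f t ≤ B) : ∃ c, f a ≤ c ∧ Tendsto f atTop (𝓝 c) := by
  have hmono : Monotone fun t => f (max t a) := fun s t hst =>
    hf (le_max_right s a) (le_max_right t a) (max_le_max_right a hst)
  have hbdd : BddAbove (range fun t => f (max t a)) :=
    ⟨B, forall_mem_range.2 fun t => hB _ (le_max_right t a)⟩
  refine ⟨⨆ t, f (max t a), by simpa using le_ciSup hbdd a,
    (tendsto_atTop_ciSup hmono hbdd).congr' ?_⟩
  filter_upwards [eventually_ge_atTop a] with t ht
  rw [max_eq_left ht]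

theorem tendsto_comp_iff_forall_mapClusterPt {α X Y : Type*} [TopologicalSpace X] [T2Space X]
    [TopologicalSpace Y] [T2Space Y] {l : Filter α} {u : α → X} {K : Set X} {φ : X → Y} {c : Y}
    (hK : IsCompact K) (hu : ∀ᶠ a in l, u a ∈ K) (hφ : ContinuousOn φ K) :
    Tendsto (fun a => φ (u a)) l (𝓝 c) ↔ ∀ y, MapClusterPt y l u → φ y = c := by
  constructor
  · intro h y hy
    obtain ⟨U, hUl, hUy⟩ := mapClusterPt_iff_ultrafilter.1 hy
    have hUK : ∀ᶠ a in U, u a ∈ K := hUl hu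
    have hφU := (hφ y (hK.isClosed.mem_of_tendsto hUy hUK)).tendsto.comp
      (tendsto_nhdsWithin_iff.2 ⟨hUy, hUK⟩)
    exact tendsto_nhds_unique hφU (h.mono_left hUl)
  · intro h
    refine tendsto_iff_ultrafilter _ _ _ |>.2 fun U hUl => ?_
    have hUK : K ∈ U.map u := hUl hu
    obtain ⟨y, hyK, hUy⟩ := hK.ultrafilter_le_nhds' (U.map u) hUK
    rw [← h y (mapClusterPt_iff_ultrafilter.2 ⟨U, hUl, hUy⟩)]
    exact (hφ y hyK).tendsto.comp (le_inf hUy (le_principal_iff.2 hUK))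

section LimitSets

variable {X : Type*} [UniformSpace X] [T2Space X] {K : Set X} {γ : ℝ → X} {f g : X → ℝ}

theorem eq_zero_of_mapClusterPt_of_hasDerivWithinAt {c : ℝ} (hK : IsCompact K)
    (hγ : UniformContinuousOn γ (Ici 0)) (hγK : MapsTo γ (Ici 0) K)
    (hf : ContinuousOn f K) (hg : ContinuousOn g K)
    (hfg : ∀ t ∈ Ici (0 : ℝ), HasDerivWithinAt (fun s => f (γ s)) (g (γ t)) (Ici 0) t)
    (hc : ∀ y, MapClusterPt y atTop γ → f y = c) {y : X} (hy : MapClusterPt y atTop γ) :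
    g y = 0 := by
  have hev : ∀ᶠ t in atTop, γ t ∈ K := (eventually_ge_atTop 0).mono fun t ht => hγK ht
  have hguc : UniformContinuousOn (fun t => g (γ t)) (Ici 0) :=
    (hK.uniformContinuousOn_of_continuous hg).comp hγ hγK
  have hlim := (tendsto_comp_iff_forall_mapClusterPt hK hev hf).2 hc
  exact (tendsto_comp_iff_forall_mapClusterPt hK hev hg).1
    (tendsto_deriv_zero_of_tendsto hfg hguc hlim) y hy

/-- LaSalle's invariance principle. -/
theorem exists_forall_mapClusterPt_eq_and_deriv_eq_zero (hK : IsCompact K)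
    (hγ : UniformContinuousOn γ (Ici 0)) (hγK : MapsTo γ (Ici 0) K)
    (hf : ContinuousOn f K) (hg : ContinuousOn g K)
    (hfg : ∀ t ∈ Ici (0 : ℝ), HasDerivWithinAt (fun s => f (γ s)) (g (γ t)) (Ici 0) t)
    (hg0 : ∀ y ∈ K, 0 ≤ g y) :
    ∃ c, f (γ 0) ≤ c ∧ ∀ y, MapClusterPt y atTop γ → f y = c ∧ g y = 0 := by
  have hev : ∀ᶠ t in atTop, γ t ∈ K := (eventually_ge_atTop 0).mono fun t ht => hγK ht
  obtain ⟨B, hB⟩ := hK.bddAbove_image hf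
  obtain ⟨c, h0c, hc⟩ := exists_tendsto_atTop_of_monotoneOn_Ici
    (monotoneOn_Ici_of_hasDerivWithinAt_nonneg hfg fun t ht => hg0 _ (hγK ht))
    fun t ht => hB (mem_image_of_mem f (hγK ht))
  have hconst := (tendsto_comp_iff_forall_mapClusterPt hK hev hf).1 hc
  exact ⟨c, h0c, fun y hy => ⟨hconst y hy,
    eq_zero_of_mapClusterPt_of_hasDerivWithinAt hK hγ hγK hf hg hfg hconst hy⟩⟩

end LimitSets

theorem forall_mem_Ici_of_forall_Ico_imp {X : Type*} [TopologicalSpace X] {γ : ℝ → X} {U : Set X}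
    {a : ℝ} (hγ : ContinuousOn γ (Ici a)) (hU : IsOpen U) (ha : γ a ∈ U)
    (step : ∀ T, a < T → (∀ t ∈ Ico a T, γ t ∈ U) → γ T ∈ U) : ∀ t ∈ Ici a, γ t ∈ U := by
  by_contra! hexit
  obtain ⟨t, hta, htU⟩ := hexit
  set B := {t ∈ Ici a | γ t ∉ U}
  have hBne : B.Nonempty := ⟨t, hta, htU⟩
  have hBbdd : BddBelow B := ⟨a, fun s hs => hs.1⟩
  have hBclosed : IsClosed B := hγ.preimage_isClosed_of_isClosed isClosed_Ici hU.isClosed_compl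
  have hT : sInf B ∈ B := hBclosed.csInf_mem hBne hBbdd
  have hlt : a < sInf B := lt_of_le_of_ne hT.1 fun h => hT.2 (h ▸ ha)
  refine hT.2 (step _ hlt fun s hs => by_contra fun hsU => ?_)
  exact (csInf_le hBbdd ⟨hs.1, hsU⟩).not_gt hs.2

/-- The logarithmic derivative of `f` within `s` at `t` is `r`, that is, `f' = r f`; no division
is involved, so that `f t = 0` is allowed. -/
def HasLogDerivWithinAt (f : ℝ → ℝ) (r : ℝ) (s : Set ℝ) (t : ℝ) : Prop :=
  HasDerivWithinAt f (r * f t) s t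

namespace HasLogDerivWithinAt

variable {f g : ℝ → ℝ} {p q c t : ℝ} {s : Set ℝ}

theorem mul (hf : HasLogDerivWithinAt f p s t) (hg : HasLogDerivWithinAt g q s t) :
    HasLogDerivWithinAt (fun x => f x * g x) (p + q) s t :=
  (HasDerivWithinAt.mul hf hg).congr_deriv (by ring)

theorem sub (hf : HasLogDerivWithinAt f p s t) (hg : HasLogDerivWithinAt g p s t) :
    HasLogDerivWithinAt (fun x => f x - g x) p s t :=
  (HasDerivWithinAt.sub hf hg).congr_deriv (by ring)

theorem const_mul (c : ℝ) (hf : HasLogDerivWithinAt f p s t) :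
    HasLogDerivWithinAt (fun x => c * f x) p s t :=
  (HasDerivWithinAt.const_mul c hf).congr_deriv (by ring)

theorem inv (hf : HasLogDerivWithinAt f p s t) (h0 : f t ≠ 0) :
    HasLogDerivWithinAt (fun x => (f x)⁻¹) (-p) s t :=
  (HasDerivWithinAt.inv hf h0).congr_deriv (by field_simp)

theorem rpow_const (hf : HasLogDerivWithinAt f p s t) (h0 : 0 < f t) :
    HasLogDerivWithinAt (fun x => f x ^ c) (c * p) s t :=
  (HasDerivWithinAt.rpow_const hf (.inl h0.ne')).congr_deriv <| by
    rw [Real.rpow_sub_one h0.ne']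
    field_simp

theorem eq_mul_exp_integral {r : ℝ → ℝ} {a b : ℝ}
    (hf : ∀ x ∈ Icc a b, HasLogDerivWithinAt f (r x) (Icc a b) x) (hr : ContinuousOn r (Icc a b))
    (ht : t ∈ Icc a b) : f t = f a * Real.exp (∫ x in a..t, r x) := by
  have hexp : ∀ x ∈ Icc a b, HasLogDerivWithinAt
      (fun u => Real.exp (-∫ z in a..u, r z)) (-r x) (Icc a b) x := by
    intro x hx
    have : Fact (x ∈ Icc a b) := ⟨hx⟩
    have hax : IntervalIntegrable r MeasureTheory.volume a x :=
      (hr.mono (uIcc_of_le hx.1 ▸ Icc_subset_Icc_right hx.2)).intervalIntegrable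
    have hint := intervalIntegral.integral_hasDerivWithinAt_right (s := Icc a b) hax
      (hr.stronglyMeasurableAtFilter_nhdsWithin measurableSet_Icc x) (hr x hx)
    exact hint.neg.exp.congr_deriv (mul_comm _ _)
  have hprod : ∀ x ∈ Icc a b, HasDerivWithinAt
      (fun u => f u * Real.exp (-∫ z in a..u, r z)) 0 (Icc a b) x := fun x hx =>
    ((hf x hx).mul (hexp x hx)).congr_deriv (by ring)
  have hconst := constant_of_derivWithin_zero (fun x hx => (hprod x hx).differentiableWithinAt)
    (fun x hx => (hprod x (Ico_subset_Icc_self hx)).derivWithin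
      (uniqueDiffOn_Icc (hx.1.trans_lt hx.2) x (Ico_subset_Icc_self hx))) t ht
  simp only [intervalIntegral.integral_same, neg_zero, Real.exp_zero, mul_one] at hconst
  rw [← hconst, mul_assoc, ← Real.exp_add, neg_add_cancel, Real.exp_zero, mul_one]

end HasLogDerivWithinAt

noncomputable section

/-- The inequalities defining the state space, without the Codazzi constraint. -/
def physicalRegion : Set State :=
  {S | 0 ≤ sigTildeSq S ∧ 0 ≤ sigCheckSq S ∧ 0 ≤ omK S ∧ 0 ≤ vSq S ∧ vSq S ≤ 1 ∧ 0 ≤ om S}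

/-- The part of `physicalRegion` where all inequalities are strict. -/
def genericRegion : Set State :=
  {S | 0 < sigTildeSq S ∧ 0 < sigCheckSq S ∧ 0 < omK S ∧ 0 < vSq S ∧ 0 < 1 - vSq S ∧ 0 < om S}

/-- The normalized shear variable `Σ̄ / √3`, which makes the evolution equations rational. -/
def scaledBar (S : State) : ℝ := sigBar S / √3

/-- The matter variable `Ω / G₊`, in which the evolution equations are polynomial up to the factor
`G₋⁻¹`. -/
def omDivG (w : ℝ) (S : State) : ℝ := (gPlus w S)⁻¹ * om S

theorem genericRegion_subset_physicalRegion : genericRegion ⊆ physicalRegion :=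
  fun _ ⟨hT, hC, hK, hv, hv', hO⟩ => ⟨hT.le, hC.le, hK.le, hv.le, (sub_pos.1 hv').le, hO.le⟩

theorem stateSpace_subset_physicalRegion {w : ℝ} : stateSpace w ⊆ physicalRegion :=
  fun _ hS => hS.2

theorem mem_sGen_iff {w : ℝ} {S : State} :
    S ∈ sGen w ↔ S ∈ genericRegion ∧ codazzi w S = 0 := by
  constructor
  · rintro ⟨⟨hcod, hT, hC, hK, hv, hv', hO⟩, hne⟩
    simp only [mul_ne_zero_iff] at hne
    obtain ⟨⟨⟨⟨⟨hv1, hv0⟩, hT0⟩, hC0⟩, hO0⟩, hK0⟩ := hne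
    exact ⟨⟨hT.lt_of_ne' hT0, hC.lt_of_ne' hC0, hK.lt_of_ne' hK0, hv.lt_of_ne' hv0,
      (sub_nonneg.2 hv').lt_of_ne' hv1, hO.lt_of_ne' hO0⟩, hcod⟩
  · rintro ⟨hS, hcod⟩
    refine ⟨⟨hcod, genericRegion_subset_physicalRegion hS⟩, ?_⟩
    obtain ⟨hT, hC, hK, hv, hv', hO⟩ := hS
    positivity

theorem continuous_om : Continuous om := by unfold om sigSq; fun_prop

theorem continuous_scaledBar : Continuous scaledBar := by unfold scaledBar; fun_prop

theorem isOpen_genericRegion : IsOpen genericRegion := by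
  exact (isOpen_lt continuous_const (continuous_apply 2)).inter <|
    (isOpen_lt continuous_const (continuous_apply 3)).inter <|
    (isOpen_lt continuous_const (continuous_apply 4)).inter <|
    (isOpen_lt continuous_const (continuous_apply 5)).inter <|
    (isOpen_lt continuous_const (continuous_const.sub (continuous_apply 5))).inter
      (isOpen_lt continuous_const continuous_om)

theorem isClosed_physicalRegion : IsClosed physicalRegion := by
  exact (isClosed_le continuous_const (continuous_apply 2)).inter <|
    (isClosed_le continuous_const (continuous_apply 3)).inter <|
    (isClosed_le continuous_const (continuous_apply 4)).inter <|
    (isClosed_le continuous_const (continuous_apply 5)).inter <|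
    (isClosed_le (continuous_apply 5) continuous_const).inter
      (isClosed_le continuous_const continuous_om)

theorem sq_add_sq_add_add_add_add_om (S : State) :
    sigPlus S ^ 2 + sigBar S ^ 2 + sigTildeSq S + sigCheckSq S + omK S + om S = 1 := by
  unfold om sigSq
  ring

theorem physicalRegion_subset_closedBall : physicalRegion ⊆ Metric.closedBall 0 1 := by
  rintro S ⟨hT, hC, hK, hv, hv', hO⟩
  have hsum := sq_add_sq_add_add_add_add_om S
  have hp := sq_nonneg (sigPlus S)
  have hb := sq_nonneg (sigBar S)
  refine mem_closedBall_zero_iff.2 ((pi_norm_le_iff_of_nonneg zero_le_one).2 fun i => ?_)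
  match i with
  | 0 => exact (sq_le_one_iff_abs_le_one _).1 (by linarith)
  | 1 => exact (sq_le_one_iff_abs_le_one _).1 (by linarith)
  | 2 | 3 | 4 | 5 => exact abs_le.2 ⟨by linarith, by linarith⟩

theorem isCompact_physicalRegion : IsCompact physicalRegion :=
  Metric.isCompact_of_isClosed_isBounded isClosed_physicalRegion
    (Metric.isBounded_closedBall.subset physicalRegion_subset_closedBall)

variable {w : ℝ} {S : State}

theorem gPlus_pos (hw : -1 < w) (hS : S ∈ physicalRegion) : 0 < gPlus w S := by
  obtain ⟨-, -, -, hv, hv', -⟩ := hS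
  unfold gPlus
  rcases le_total 0 w with h | h <;> nlinarith

theorem gMinus_pos (hw' : w < 1) (hS : S ∈ physicalRegion) : 0 < gMinus w S := by
  have h : gMinus w S = gPlus (-w) S := by
    unfold gMinus gPlus
    ring
  exact h ▸ gPlus_pos (neg_lt_neg hw') hS

theorem continuousOn_inv_gPlus (hw : -1 < w) :
    ContinuousOn (fun S => (gPlus w S)⁻¹) physicalRegion :=
  ContinuousOn.inv₀ (by unfold gPlus; fun_prop) fun _ hS => (gPlus_pos hw hS).ne'

theorem continuousOn_inv_gMinus (hw' : w < 1) :
    ContinuousOn (fun S => (gMinus w S)⁻¹) physicalRegion :=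
  ContinuousOn.inv₀ (by unfold gMinus; fun_prop) fun _ hS => (gMinus_pos hw' hS).ne'

theorem continuousOn_omDivG (hw : -1 < w) : ContinuousOn (omDivG w) physicalRegion :=
  (continuousOn_inv_gPlus hw).mul continuous_om.continuousOn

theorem continuousOn_decel (hw : -1 < w) : ContinuousOn (decel w) physicalRegion := by
  have hg := continuousOn_inv_gPlus hw
  have hom := continuous_om.continuousOn (s := physicalRegion)
  unfold decel sigSq
  fun_prop

theorem continuousOn_codazzi (hw : -1 < w) : ContinuousOn (codazzi w) physicalRegion := by
  have hg := continuousOn_inv_gPlus hw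
  have hom := continuous_om.continuousOn (s := physicalRegion)
  unfold codazzi
  fun_prop

theorem isCompact_stateSpace (hw : -1 < w) : IsCompact (stateSpace w) := by
  have hEq : stateSpace w = physicalRegion ∩ codazzi w ⁻¹' {0} := by
    ext S
    exact and_comm
  rw [hEq]
  exact isCompact_physicalRegion.of_isClosed_subset
    ((continuousOn_codazzi hw).preimage_isClosed_of_isClosed isClosed_physicalRegion
      isClosed_singleton) inter_subset_left

theorem sigBar_eq (S : State) : sigBar S = √3 * scaledBar S := by
  unfold scaledBar
  field_simp

theorem sqrt_three_mul_sigBar (S : State) : √3 * sigBar S = 3 * scaledBar S := by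
  rw [sigBar_eq, ← mul_assoc, Real.mul_self_sqrt (by norm_num)]

theorem sigBar_sq (S : State) : sigBar S ^ 2 = 3 * scaledBar S ^ 2 := by
  rw [sigBar_eq, mul_pow, Real.sq_sqrt (by norm_num)]

theorem om_eq (hw : -1 < w) (hS : S ∈ physicalRegion) :
    om S = omDivG w S * (1 + w * vSq S) := by
  change om S = (gPlus w S)⁻¹ * om S * gPlus w S
  have hg := (gPlus_pos hw hS).ne'
  field_simp

theorem omDivG_nonneg (hw : -1 < w) (hS : S ∈ physicalRegion) : 0 ≤ omDivG w S :=
  mul_nonneg (inv_nonneg.2 (gPlus_pos hw hS).le) hS.2.2.2.2.2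

theorem gauss_constraint (hw : -1 < w) (hS : S ∈ physicalRegion) :
    sigPlus S ^ 2 + 3 * scaledBar S ^ 2 + sigTildeSq S + sigCheckSq S + omK S
      + omDivG w S * (1 + w * vSq S) = 1 := by
  rw [← om_eq hw hS, ← sigBar_sq]
  exact sq_add_sq_add_add_add_add_om S

theorem decel_eq (hw : -1 < w) (hS : S ∈ physicalRegion) :
    decel w S = 2 - 2 * omK S
      - (1 / 2) * omDivG w S * (3 * (1 - w) + (5 * w - 1) * vSq S) := by
  have hq : decel w S = 2 * (1 - om S - omK S)
      + (1 / 2) * (1 + 3 * w + (1 - w) * vSq S) * omDivG w S := by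
    unfold decel omDivG om
    ring
  rw [hq, om_eq hw hS]
  ring

theorem codazzi_eq (w : ℝ) (S : State) :
    codazzi w S = 4 * (sigCheckSq S * omK S)
      - (1 + w) ^ 2 * (vSq S * (omDivG w S * omDivG w S)) := by
  unfold codazzi omDivG
  ring

theorem codazzi_constraint (hS : S ∈ stateSpace w) :
    4 * sigCheckSq S * omK S = (1 + w) ^ 2 * vSq S * omDivG w S ^ 2 := by
  linear_combination hS.1 - codazzi_eq w S

/-- The inhomogeneous part of the equation for `Σ₊`. -/
def plusSource (w : ℝ) (S : State) : ℝ :=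
  -3 * sigCheckSq S + 4 * omK S + (1 / 2) * (1 + w) * vSq S * omDivG w S

/-- The inhomogeneous part of the equation for `Σ̄ / √3`. -/
def barSource (w : ℝ) (S : State) : ℝ :=
  -2 * sigTildeSq S + sigCheckSq S + (1 / 2) * (1 + w) * vSq S * omDivG w S

/-- The logarithmic derivative of `Σ̃²` along the flow. -/
def tildeRate (w : ℝ) (S : State) : ℝ := -2 * (2 - decel w S - 6 * scaledBar S)

/-- The logarithmic derivative of `Σ̌²` along the flow. -/
def checkRate (w : ℝ) (S : State) : ℝ :=
  -2 * (2 - decel w S - 3 * sigPlus S + 3 * scaledBar S)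

/-- The logarithmic derivative of `Ω_k` along the flow. -/
def curvRate (w : ℝ) (S : State) : ℝ := 2 * (decel w S - 4 * sigPlus S)

/-- The logarithmic derivative of `v² / (1 - v²)` along the flow. -/
def tiltRate (w : ℝ) (S : State) : ℝ :=
  2 * (gMinus w S)⁻¹ * (3 * w - 1 - sigPlus S - 3 * scaledBar S)

/-- The logarithmic derivative of `Ω` along the flow. -/
def omRate (w : ℝ) (S : State) : ℝ :=
  2 * decel w S - (1 + 3 * w)
    + (1 + w) * vSq S * (gPlus w S)⁻¹ * (3 * w - 1 - sigPlus S - 3 * scaledBar S)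

/-- The logarithmic derivative of `Ω / G₊` along the flow. -/
def omDivGRate (w : ℝ) (S : State) : ℝ :=
  omRate w S - w * vSq S * (1 - vSq S) * tiltRate w S * (gPlus w S)⁻¹

theorem continuousOn_tildeRate (hw : -1 < w) : ContinuousOn (tildeRate w) physicalRegion := by
  have hq := continuousOn_decel hw
  have hX := continuous_scaledBar
  unfold tildeRate
  fun_prop

theorem continuousOn_checkRate (hw : -1 < w) : ContinuousOn (checkRate w) physicalRegion := by
  have hq := continuousOn_decel hw
  have hX := continuous_scaledBar
  unfold checkRate
  fun_prop

theorem continuousOn_curvRate (hw : -1 < w) : ContinuousOn (curvRate w) physicalRegion := by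
  have hq := continuousOn_decel hw
  unfold curvRate
  fun_prop

theorem continuousOn_tiltRate (hw' : w < 1) : ContinuousOn (tiltRate w) physicalRegion := by
  have hg := continuousOn_inv_gMinus hw'
  have hX := continuous_scaledBar
  unfold tiltRate
  fun_prop

theorem continuousOn_omRate (hw : -1 < w) : ContinuousOn (omRate w) physicalRegion := by
  have hg := continuousOn_inv_gPlus hw
  have hq := continuousOn_decel hw
  have hX := continuous_scaledBar
  unfold omRate
  fun_prop

theorem continuousOn_plusSource (hw : -1 < w) : ContinuousOn (plusSource w) physicalRegion := by
  have hU := continuousOn_omDivG hw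
  unfold plusSource
  fun_prop

theorem continuousOn_barSource (hw : -1 < w) : ContinuousOn (barSource w) physicalRegion := by
  have hU := continuousOn_omDivG hw
  unfold barSource
  fun_prop

section Flow

variable {γ : ℝ → State} {s : Set ℝ} {t : ℝ}

theorem hasDerivWithinAt_sigPlus (h : HasDerivWithinAt γ (field w (γ t)) s t) :
    HasDerivWithinAt (fun τ => sigPlus (γ τ))
      (-(2 - decel w (γ t)) * sigPlus (γ t) + plusSource w (γ t)) s t :=
  (hasDerivWithinAt_pi.1 h 0).congr_deriv <| by
    simp only [field, plusSource, omDivG, Matrix.cons_val]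
    ring

theorem hasDerivWithinAt_scaledBar (h : HasDerivWithinAt γ (field w (γ t)) s t) :
    HasDerivWithinAt (fun τ => scaledBar (γ τ))
      (-(2 - decel w (γ t)) * scaledBar (γ t) + barSource w (γ t)) s t :=
  ((hasDerivWithinAt_pi.1 h 1).div_const √3).congr_deriv <| by
    simp only [field, barSource, omDivG, scaledBar, Matrix.cons_val]
    field_simp
    ring

theorem hasLogDerivWithinAt_sigTildeSq (h : HasDerivWithinAt γ (field w (γ t)) s t) :
    HasLogDerivWithinAt (fun τ => sigTildeSq (γ τ)) (tildeRate w (γ t)) s t :=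
  (hasDerivWithinAt_pi.1 h 2).congr_deriv <| by
    simp only [field, tildeRate, Matrix.cons_val]
    linear_combination 4 * sigTildeSq (γ t) * sqrt_three_mul_sigBar (γ t)

theorem hasLogDerivWithinAt_sigCheckSq (h : HasDerivWithinAt γ (field w (γ t)) s t) :
    HasLogDerivWithinAt (fun τ => sigCheckSq (γ τ)) (checkRate w (γ t)) s t :=
  (hasDerivWithinAt_pi.1 h 3).congr_deriv <| by
    simp only [field, checkRate, Matrix.cons_val]
    linear_combination -2 * sigCheckSq (γ t) * sqrt_three_mul_sigBar (γ t)

theorem hasLogDerivWithinAt_omK (h : HasDerivWithinAt γ (field w (γ t)) s t) :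
    HasLogDerivWithinAt (fun τ => omK (γ τ)) (curvRate w (γ t)) s t :=
  (hasDerivWithinAt_pi.1 h 4).congr_deriv <| by
    simp only [field, curvRate, Matrix.cons_val]

theorem hasLogDerivWithinAt_vSq (h : HasDerivWithinAt γ (field w (γ t)) s t) :
    HasLogDerivWithinAt (fun τ => vSq (γ τ)) ((1 - vSq (γ t)) * tiltRate w (γ t)) s t :=
  (hasDerivWithinAt_pi.1 h 5).congr_deriv <| by
    simp only [field, tiltRate, Matrix.cons_val]
    linear_combination -2 * (gMinus w (γ t))⁻¹ * (1 - vSq (γ t)) * vSq (γ t)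
      * sqrt_three_mul_sigBar (γ t)

theorem hasLogDerivWithinAt_one_sub_vSq (h : HasDerivWithinAt γ (field w (γ t)) s t) :
    HasLogDerivWithinAt (fun τ => 1 - vSq (γ τ)) (-vSq (γ t) * tiltRate w (γ t)) s t :=
  (HasDerivWithinAt.const_sub 1 (hasLogDerivWithinAt_vSq h)).congr_deriv (by ring)

theorem hasLogDerivWithinAt_om (hw : -1 < w) (h : HasDerivWithinAt γ (field w (γ t)) s t)
    (ht : γ t ∈ physicalRegion) :
    HasLogDerivWithinAt (fun τ => om (γ τ)) (omRate w (γ t)) s t := by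
  have hsum := ((((hasDerivWithinAt_sigPlus h).pow 2).add
    (((hasDerivWithinAt_scaledBar h).pow 2).const_mul 3)).add
    (hasLogDerivWithinAt_sigTildeSq h)).add (hasLogDerivWithinAt_sigCheckSq h)
  have hom : (fun τ => om (γ τ)) = fun τ => 1 - (sigPlus (γ τ) ^ 2 + 3 * scaledBar (γ τ) ^ 2
      + sigTildeSq (γ τ) + sigCheckSq (γ τ)) - omK (γ τ) := by
    funext τ
    rw [← sigBar_sq]
    rfl
  have hrate : omRate w (γ t) * om (γ t) = (2 * decel w (γ t) - (1 + 3 * w)) * om (γ t)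
      + (1 + w) * vSq (γ t) * omDivG w (γ t)
        * (3 * w - 1 - sigPlus (γ t) - 3 * scaledBar (γ t)) := by
    unfold omRate omDivG
    ring
  change HasDerivWithinAt _ (omRate w (γ t) * om (γ t)) s t
  rw [hom]
  refine ((hsum.const_sub 1).sub (hasLogDerivWithinAt_omK h)).congr_deriv ?_
  have hG := gauss_constraint hw ht
  rw [hrate, om_eq hw ht, tildeRate, checkRate, curvRate, plusSource, barSource,
    decel_eq hw ht]
  simp only [Nat.cast_ofNat, Nat.add_one_sub_one, pow_one]
  linear_combination (2 * (2 * omK (γ t)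
    + 1 / 2 * omDivG w (γ t) * (3 * (1 - w) + (5 * w - 1) * vSq (γ t)))) * hG

theorem hasLogDerivWithinAt_gPlus (hw : -1 < w) (h : HasDerivWithinAt γ (field w (γ t)) s t)
    (ht : γ t ∈ physicalRegion) :
    HasLogDerivWithinAt (fun τ => gPlus w (γ τ))
      (w * vSq (γ t) * (1 - vSq (γ t)) * tiltRate w (γ t) * (gPlus w (γ t))⁻¹) s t :=
  ((HasDerivWithinAt.const_mul w (hasLogDerivWithinAt_vSq h)).const_add 1).congr_deriv <| by
    rw [inv_mul_cancel_right₀ (gPlus_pos hw ht).ne']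
    ring

theorem hasLogDerivWithinAt_omDivG (hw : -1 < w) (h : HasDerivWithinAt γ (field w (γ t)) s t)
    (ht : γ t ∈ physicalRegion) :
    HasLogDerivWithinAt (fun τ => omDivG w (γ τ)) (omDivGRate w (γ t)) s t := by
  have hprod := ((hasLogDerivWithinAt_gPlus hw h ht).inv (gPlus_pos hw ht).ne').mul
    (hasLogDerivWithinAt_om hw h ht)
  rwa [neg_add_eq_sub] at hprod

theorem two_mul_omDivGRate_add (hw : -1 < w) (hw' : w < 1) (hS : S ∈ physicalRegion) :
    2 * omDivGRate w S + (1 - vSq S) * tiltRate w S = checkRate w S + curvRate w S := by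
  have hg := (gPlus_pos hw hS).ne'
  have hm := (gMinus_pos hw' hS).ne'
  unfold omDivGRate omRate tiltRate checkRate curvRate
  field_simp
  simp only [gPlus, gMinus]
  ring

/-- Both terms of the Codazzi constraint have the same logarithmic derivative. -/
theorem hasLogDerivWithinAt_codazzi (hw : -1 < w) (hw' : w < 1)
    (h : HasDerivWithinAt γ (field w (γ t)) s t) (ht : γ t ∈ physicalRegion) :
    HasLogDerivWithinAt (fun τ => codazzi w (γ τ)) (checkRate w (γ t) + curvRate w (γ t)) s t := by
  have hU := hasLogDerivWithinAt_omDivG hw h ht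
  have hleft := ((hasLogDerivWithinAt_sigCheckSq h).mul (hasLogDerivWithinAt_omK h)).const_mul 4
  have hright := ((hasLogDerivWithinAt_vSq h).mul (hU.mul hU)).const_mul ((1 + w) ^ 2)
  have hrate : (1 - vSq (γ t)) * tiltRate w (γ t) + (omDivGRate w (γ t) + omDivGRate w (γ t))
      = checkRate w (γ t) + curvRate w (γ t) := by
    rw [← two_mul_omDivGRate_add hw hw' ht]
    ring
  simp only [codazzi_eq]
  exact hleft.sub (hrate ▸ hright)

end Flow

section Invariance

variable {γ : ℝ → State} {T : ℝ}

theorem exists_pos_eq_mul_of_hasLogDerivWithinAt {f r : State → ℝ} (hT : 0 ≤ T)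
    (hγ : ContinuousOn γ (Icc 0 T)) (hmem : MapsTo γ (Icc 0 T) physicalRegion)
    (hr : ContinuousOn r physicalRegion)
    (hf : ∀ t ∈ Icc 0 T, HasLogDerivWithinAt (fun τ => f (γ τ)) (r (γ t)) (Icc 0 T) t) :
    ∃ c > 0, f (γ T) = f (γ 0) * c :=
  ⟨_, Real.exp_pos _,
    HasLogDerivWithinAt.eq_mul_exp_integral hf (hr.comp hγ hmem) (right_mem_Icc.2 hT)⟩

theorem mem_sGen_of_isIntegralCurveOn_Icc (hw : -1 < w) (hw' : w < 1) (hT : 0 ≤ T)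
    (h : IsIntegralCurveOn γ (fun _ => field w) (Icc 0 T))
    (hmem : MapsTo γ (Icc 0 T) physicalRegion) (h0 : γ 0 ∈ sGen w) : γ T ∈ sGen w := by
  have hγ : ContinuousOn γ (Icc 0 T) := fun t ht => (h t ht).continuousWithinAt
  have hpos : ∀ {f r : State → ℝ}, 0 < f (γ 0) → ContinuousOn r physicalRegion →
      (∀ t ∈ Icc 0 T, HasLogDerivWithinAt (fun τ => f (γ τ)) (r (γ t)) (Icc 0 T) t) →
      0 < f (γ T) := by
    intro f r hf0 hr hf
    obtain ⟨c, hc, hfT⟩ := exists_pos_eq_mul_of_hasLogDerivWithinAt hT hγ hmem hr hf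
    exact hfT ▸ mul_pos hf0 hc
  have htilt := continuousOn_tiltRate hw'
  obtain ⟨⟨hT0, hC0, hK0, hv0, hv0', hO0⟩, hcod⟩ := mem_sGen_iff.1 h0
  refine mem_sGen_iff.2 ⟨⟨?_, ?_, ?_, ?_, ?_, ?_⟩, ?_⟩
  · exact hpos hT0 (continuousOn_tildeRate hw) fun t ht => hasLogDerivWithinAt_sigTildeSq (h t ht)
  · exact hpos hC0 (continuousOn_checkRate hw) fun t ht => hasLogDerivWithinAt_sigCheckSq (h t ht)
  · exact hpos hK0 (continuousOn_curvRate hw) fun t ht => hasLogDerivWithinAt_omK (h t ht)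
  · exact hpos (r := fun S => (1 - vSq S) * tiltRate w S) hv0 (by fun_prop)
      fun t ht => hasLogDerivWithinAt_vSq (h t ht)
  · exact hpos (f := fun S => 1 - vSq S) (r := fun S => -vSq S * tiltRate w S) hv0' (by fun_prop)
      fun t ht => hasLogDerivWithinAt_one_sub_vSq (h t ht)
  · exact hpos hO0 (continuousOn_omRate hw)
      fun t ht => hasLogDerivWithinAt_om hw (h t ht) (hmem ht)
  · obtain ⟨c, -, hc⟩ := exists_pos_eq_mul_of_hasLogDerivWithinAt hT hγ hmem
      ((continuousOn_checkRate hw).add (continuousOn_curvRate hw))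
      fun t ht => hasLogDerivWithinAt_codazzi hw hw' (h t ht) (hmem ht)
    rw [hc, hcod, zero_mul]

theorem mem_sGen_of_isIntegralCurveOn_Ici (hw : -1 < w) (hw' : w < 1) {F : State → State}
    (hF : EqOn F (field w) physicalRegion) (h : IsIntegralCurveOn γ (fun _ => F) (Ici 0))
    (h0 : γ 0 ∈ sGen w) : ∀ t ∈ Ici (0 : ℝ), γ t ∈ sGen w := by
  have hγ : ContinuousOn γ (Ici 0) := fun t ht => (h t ht).continuousWithinAt
  have hsol : ∀ T, 0 ≤ T → MapsTo γ (Icc 0 T) physicalRegion → γ T ∈ sGen w := by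
    intro T hT hmem
    refine mem_sGen_of_isIntegralCurveOn_Icc hw hw' hT (fun t ht => ?_) hmem h0
    have hderiv : HasDerivWithinAt γ (F (γ t)) (Icc 0 T) t := (h t ht.1).mono Icc_subset_Ici_self
    rwa [hF (hmem ht)] at hderiv
  have hgen : ∀ t ∈ Ici (0 : ℝ), γ t ∈ genericRegion := by
    refine forall_mem_Ici_of_forall_Ico_imp hγ isOpen_genericRegion (mem_sGen_iff.1 h0).1
      fun T hT hlt => (mem_sGen_iff.1 (hsol T hT.le ?_)).1
    have hclosure : MapsTo γ (closure (Ico 0 T)) (closure physicalRegion) :=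
      MapsTo.closure_of_continuousOn
        (fun t ht => genericRegion_subset_physicalRegion (hlt t ht))
        (hγ.mono (closure_minimal Ico_subset_Ici_self isClosed_Ici))
    rwa [closure_Ico hT.ne, isClosed_physicalRegion.closure_eq] at hclosure
  exact fun T hT => hsol T hT fun t ht => genericRegion_subset_physicalRegion (hgen t ht.1)

end Invariance

theorem contDiffAt_field (hw : -1 < w) (hw' : w < 1) (hS : S ∈ physicalRegion) :
    ContDiffAt ℝ 1 (field w) S := by
  have hg := (gPlus_pos hw hS).ne'
  have hm := (gMinus_pos hw' hS).ne'
  have hginv : ContDiffAt ℝ 1 (fun S => (gPlus w S)⁻¹) S :=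
    ContDiffAt.inv (by unfold gPlus; fun_prop) hg
  have hminv : ContDiffAt ℝ 1 (fun S => (gMinus w S)⁻¹) S :=
    ContDiffAt.inv (by unfold gMinus; fun_prop) hm
  have hom : ContDiffAt ℝ 1 om S := by unfold om sigSq; fun_prop
  have hq : ContDiffAt ℝ 1 (decel w) S := by unfold decel sigSq; fun_prop
  refine contDiffAt_pi.2 fun i => ?_
  fin_cases i <;> simp only [field, Matrix.cons_val, Fin.reduceFinMk, Fin.isValue, Fin.zero_eta,
    Fin.mk_one] <;> fun_prop

theorem exists_norm_field_le (hw : -1 < w) (hw' : w < 1) :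
    ∃ M : NNReal, ∀ S ∈ physicalRegion, ‖field w S‖ ≤ M := by
  obtain ⟨M, hM⟩ := isCompact_physicalRegion.exists_bound_of_continuousOn (f := field w)
    fun S hS => (contDiffAt_field hw hw' hS).continuousAt.continuousWithinAt
  exact ⟨M.toNNReal, fun S hS => (hM S hS).trans (Real.le_coe_toNNReal M)⟩

theorem exists_isFutureOrbit (hw : -1 < w) (hw' : w < 1) {x : State} (hx : x ∈ sGen w) :
    ∃ γ, IsFutureOrbit w x γ := by
  have hloc : LocallyLipschitzOn physicalRegion (field w) := fun S hS => by
    obtain ⟨K, s, hs, h⟩ := (contDiffAt_field hw hw' hS).exists_lipschitzOnWith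
    exact ⟨K, s, mem_nhdsWithin_of_mem_nhds hs, h⟩
  obtain ⟨K, hK⟩ := hloc.exists_lipschitzOnWith_of_compact isCompact_physicalRegion
  obtain ⟨M, hM⟩ := exists_norm_field_le hw hw'
  obtain ⟨F, hFK, hFM, hF⟩ := exists_lipschitzWith_bounded_extension hK hM
  obtain ⟨γ, h0, hγ⟩ := exists_isIntegralCurveOn_Ici hFK hFM x
  have hmem := mem_sGen_of_isIntegralCurveOn_Ici hw hw' hF.symm hγ (h0 ▸ hx)
  refine ⟨γ, h0, fun t ht => ?_⟩
  exact (hγ t ht).congr_deriv (hF (stateSpace_subset_physicalRegion (hmem t ht).1)).symm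

/-- `γ` solves the evolution equations on `[0, ∞)` and starts in `S_Gen`, for an equation of state
parameter in the admissible range. -/
structure IsGenOrbit (w : ℝ) (γ : ℝ → State) : Prop where
  neg_one_lt : -1 < w
  lt_one : w < 1
  mem_sGen_zero : γ 0 ∈ sGen w
  isIntegralCurveOn : IsIntegralCurveOn γ (fun _ => field w) (Ici 0)

namespace IsGenOrbit

variable {γ : ℝ → State}

theorem mem_sGen (hγ : IsGenOrbit w γ) : MapsTo γ (Ici 0) (sGen w) :=
  mem_sGen_of_isIntegralCurveOn_Ici hγ.neg_one_lt hγ.lt_one (eqOn_refl _ _) hγ.isIntegralCurveOn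
    hγ.mem_sGen_zero

theorem mem_stateSpace (hγ : IsGenOrbit w γ) : MapsTo γ (Ici 0) (stateSpace w) :=
  fun _ ht => (hγ.mem_sGen ht).1

theorem eventually_mem_stateSpace (hγ : IsGenOrbit w γ) : ∀ᶠ t in atTop, γ t ∈ stateSpace w :=
  (eventually_ge_atTop 0).mono hγ.mem_stateSpace

theorem uniformContinuousOn (hγ : IsGenOrbit w γ) : UniformContinuousOn γ (Ici 0) := by
  obtain ⟨M, hM⟩ := exists_norm_field_le hγ.neg_one_lt hγ.lt_one
  exact ((convex_Ici 0).lipschitzOnWith_of_nnnorm_hasDerivWithin_le hγ.isIntegralCurveOn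
    fun t ht => hM _ (stateSpace_subset_physicalRegion (hγ.mem_stateSpace ht))).uniformContinuousOn

theorem mem_stateSpace_of_mapClusterPt (hγ : IsGenOrbit w γ) {y : State}
    (hy : MapClusterPt y atTop γ) : y ∈ stateSpace w :=
  (isCompact_stateSpace hγ.neg_one_lt).isClosed.mem_of_mapClusterPt hy
    hγ.eventually_mem_stateSpace

theorem exists_mapClusterPt (hγ : IsGenOrbit w γ) : ∃ y, MapClusterPt y atTop γ := by
  obtain ⟨y, -, hy⟩ := (isCompact_stateSpace hγ.neg_one_lt).exists_mapClusterPt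
    (le_principal_iff.2 hγ.eventually_mem_stateSpace)
  exact ⟨y, hy⟩

theorem omegaSet_eq_singleton (hγ : IsGenOrbit w γ) {p : State}
    (h : ∀ y, MapClusterPt y atTop γ → y = p) : omegaSet γ = {p} := by
  obtain ⟨p', hp'⟩ := hγ.exists_mapClusterPt
  obtain rfl := h p' hp'
  ext y
  unfold omegaSet
  rw [mem_omegaLimit_singleton_iff_mapClusterPt, mem_singleton_iff]
  exact ⟨h y, fun hyp => hyp ▸ hp'⟩

end IsGenOrbit

/-- The matter factor of the monotone functions: `Ω / G₊` times the power of `1 - v²` that makes the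
logarithmic derivative independent of the tilt. -/
def matterDensity (w : ℝ) (S : State) : ℝ := omDivG w S * (1 - vSq S) ^ ((1 - w) / 2)

/-- The logarithmic derivative of `matterDensity` along the flow. -/
def matterRate (w : ℝ) (S : State) : ℝ := 2 * decel w S - (1 + 3 * w)

theorem omDivG_pos (hw : -1 < w) (hS : S ∈ genericRegion) : 0 < omDivG w S :=
  mul_pos (inv_pos.2 (gPlus_pos hw (genericRegion_subset_physicalRegion hS))) hS.2.2.2.2.2

theorem matterDensity_nonneg (hw : -1 < w) (hS : S ∈ physicalRegion) : 0 ≤ matterDensity w S :=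
  mul_nonneg (omDivG_nonneg hw hS) (Real.rpow_nonneg (sub_nonneg.2 hS.2.2.2.2.1) _)

theorem matterDensity_pos (hw : -1 < w) (hS : S ∈ genericRegion) : 0 < matterDensity w S :=
  mul_pos (omDivG_pos hw hS) (Real.rpow_pos_of_pos hS.2.2.2.2.1 _)

theorem continuousOn_matterDensity (hw : -1 < w) (hw' : w < 1) :
    ContinuousOn (matterDensity w) physicalRegion :=
  (continuousOn_omDivG hw).mul <| Continuous.continuousOn <|
    (continuous_const.sub (continuous_apply 5)).rpow_const fun _ => Or.inr (by linarith)

theorem omDivGRate_eq (hw : -1 < w) (hw' : w < 1) (hS : S ∈ physicalRegion) :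
    omDivGRate w S = matterRate w S + (1 - w) / 2 * (vSq S * tiltRate w S) := by
  have hg := (gPlus_pos hw hS).ne'
  have hm := (gMinus_pos hw' hS).ne'
  unfold omDivGRate matterRate omRate tiltRate
  field_simp
  simp only [gPlus, gMinus]
  ring

theorem hasLogDerivWithinAt_matterDensity {γ : ℝ → State} {s : Set ℝ} {t : ℝ} (hw : -1 < w)
    (hw' : w < 1) (h : HasDerivWithinAt γ (field w (γ t)) s t) (ht : γ t ∈ genericRegion) :
    HasLogDerivWithinAt (fun τ => matterDensity w (γ τ)) (matterRate w (γ t)) s t := by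
  have hmem := genericRegion_subset_physicalRegion ht
  have hprod := (hasLogDerivWithinAt_omDivG hw h hmem).mul
    ((hasLogDerivWithinAt_one_sub_vSq h).rpow_const (c := (1 - w) / 2) ht.2.2.2.2.1)
  have hrate : omDivGRate w (γ t) + (1 - w) / 2 * (-vSq (γ t) * tiltRate w (γ t))
      = matterRate w (γ t) := by
    rw [omDivGRate_eq hw hw' hmem]
    ring
  exact hrate ▸ hprod

/-- The exponents in a monotone function, and the fixed values of `Σ₊` and `Σ̄ / √3` at the
equilibrium to which it belongs; these also enter the monotone function, through `Weights.lin`. -/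
structure Weights where
  /-- The exponent of `Σ̃²`. -/
  tilde : ℝ
  /-- The exponent of `Σ̌²`. -/
  check : ℝ
  /-- The exponent of `Ω_k`. -/
  curv : ℝ
  /-- The exponent of `matterDensity`. -/
  matter : ℝ
  /-- The value of `Σ₊`. -/
  plus : ℝ
  /-- The value of `Σ̄ / √3`. -/
  bar : ℝ

namespace Weights

/-- The sum of the exponents. -/
def total (W : Weights) : ℝ := W.tilde + W.check + W.curv + W.matter

/-- The squared length of the vector `(Σ₊, Σ̄)` at the equilibrium. -/
def normSq (W : Weights) : ℝ := W.plus ^ 2 + 3 * W.bar ^ 2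

/-- One minus the inner product of `(Σ₊, Σ̄)` with its value at the equilibrium; the denominator of
the monotone function. -/
def lin (W : Weights) (S : State) : ℝ := 1 - W.plus * sigPlus S - 3 * W.bar * scaledBar S

/-- The logarithmic derivative of `lin` along the flow. -/
def linRate (W : Weights) (w : ℝ) (S : State) : ℝ :=
  ((2 - decel w S) - W.plus * plusSource w S - 3 * W.bar * barSource w S) / W.lin S
    - (2 - decel w S)

/-- The monotone function with the given exponents. The exponent of `lin` is the one for which the
terms `q * lin` cancel in `lin * monotoneRate`. -/
def monotoneFn (W : Weights) (w : ℝ) (S : State) : ℝ :=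
  sigTildeSq S ^ W.tilde * sigCheckSq S ^ W.check * omK S ^ W.curv * matterDensity w S ^ W.matter
    * W.lin S ^ (-2 * W.total)

/-- The logarithmic derivative of `monotoneFn` along the flow. -/
def monotoneRate (W : Weights) (w : ℝ) (S : State) : ℝ :=
  W.tilde * tildeRate w S + W.check * checkRate w S + W.curv * curvRate w S
    + W.matter * matterRate w S + -2 * W.total * W.linRate w S

/-- A quadratic form in the difference of `(Σ₊, Σ̄)` and its value at the equilibrium, positive
definite when `normSq < 1`. -/
def dev (W : Weights) (S : State) : ℝ :=
  (1 - W.normSq) * ((sigPlus S - W.plus) ^ 2 + 3 * (scaledBar S - W.bar) ^ 2)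
    + (W.plus * (sigPlus S - W.plus) + 3 * W.bar * (scaledBar S - W.bar)) ^ 2

variable {W : Weights}

theorem continuous_lin : Continuous W.lin := by
  have hX := continuous_scaledBar
  unfold lin
  fun_prop

theorem lin_pos (hW : W.normSq < 1) (hS : S ∈ physicalRegion) : 0 < W.lin S := by
  have hshear : sigPlus S ^ 2 + 3 * scaledBar S ^ 2 ≤ 1 := by
    have hsum := sq_add_sq_add_add_add_add_om S
    rw [sigBar_sq] at hsum
    obtain ⟨hT, hC, hK, -, -, hO⟩ := hS
    linarith
  have cauchy_schwarz : (W.plus * sigPlus S + 3 * W.bar * scaledBar S) ^ 2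
      ≤ W.normSq * (sigPlus S ^ 2 + 3 * scaledBar S ^ 2) := by
    unfold normSq
    linarith [sq_nonneg (W.plus * scaledBar S - W.bar * sigPlus S)]
  have hnorm : 0 ≤ W.normSq := by unfold normSq; positivity
  have hinner : (W.plus * sigPlus S + 3 * W.bar * scaledBar S) ^ 2 < 1 :=
    cauchy_schwarz.trans_lt ((mul_le_of_le_one_right hnorm hshear).trans_lt hW)
  have hlt := (abs_lt.1 ((sq_lt_one_iff_abs_lt_one _).1 hinner)).2
  unfold lin
  linarith

theorem eq_of_dev_eq_zero (hW : W.normSq < 1) (hS : W.dev S = 0) :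
    sigPlus S = W.plus ∧ scaledBar S = W.bar := by
  unfold dev at hS
  have hsum : (sigPlus S - W.plus) ^ 2 + 3 * (scaledBar S - W.bar) ^ 2 ≤ 0 := by
    have hcross := sq_nonneg (W.plus * (sigPlus S - W.plus) + 3 * W.bar * (scaledBar S - W.bar))
    exact nonpos_of_mul_nonpos_right (by linarith) (sub_pos.2 hW)
  have hplus := sq_nonneg (sigPlus S - W.plus)
  have hbar := sq_nonneg (scaledBar S - W.bar)
  exact ⟨sub_eq_zero.1 (pow_eq_zero_iff two_ne_zero |>.1 (by linarith)),
    sub_eq_zero.1 (pow_eq_zero_iff two_ne_zero |>.1 (by linarith))⟩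

theorem dev_nonneg (hW : W.normSq < 1) : 0 ≤ W.dev S := by
  unfold dev
  positivity

theorem hasLogDerivWithinAt_lin {γ : ℝ → State} {s : Set ℝ} {t : ℝ}
    (h : HasDerivWithinAt γ (field w (γ t)) s t) (hl : W.lin (γ t) ≠ 0) :
    HasLogDerivWithinAt (fun τ => W.lin (γ τ)) (W.linRate w (γ t)) s t := by
  refine ((((hasDerivWithinAt_sigPlus h).const_mul W.plus).const_sub 1).sub
    ((hasDerivWithinAt_scaledBar h).const_mul (3 * W.bar))).congr_deriv ?_
  rw [linRate, sub_mul, div_mul_cancel₀ _ hl]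
  unfold lin
  ring

/-- With `normSq < 1`, nonnegative exponents and a nonnegative remainder `rest`, the equation for
`lin * monotoneRate` says that `monotoneFn` increases along the flow, strictly unless the shear
has its equilibrium value and `rest` vanishes. -/
structure IsLyapunov (W : Weights) (w : ℝ) (rest : State → ℝ) : Prop where
  tilde_nonneg : 0 ≤ W.tilde
  check_nonneg : 0 ≤ W.check
  curv_nonneg : 0 ≤ W.curv
  matter_nonneg : 0 ≤ W.matter
  normSq_lt_one : W.normSq < 1
  rest_nonneg : ∀ S ∈ stateSpace w, 0 ≤ rest S
  lin_mul_monotoneRate : ∃ N > 0, ∀ S ∈ stateSpace w,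
    W.lin S * W.monotoneRate w S = N * W.dev S + rest S

theorem lin_mul_monotoneRate_eq (hW : W.normSq < 1) (hw : -1 < w) (hS : S ∈ physicalRegion) :
    W.lin S * W.monotoneRate w S
      = W.lin S * (4 * (W.curv + W.matter) - (1 + 3 * w) * W.matter
          + (6 * W.check - 8 * W.curv) * sigPlus S + 6 * (2 * W.tilde - W.check) * scaledBar S)
        - 2 * W.total * (2 * omK S
          + (1 / 2) * omDivG w S * (3 * (1 - w) + (5 * w - 1) * vSq S)
          - W.plus * plusSource w S - 3 * W.bar * barSource w S) := by
  have hlin : W.lin S * W.linRate w S = (2 - decel w S) - W.plus * plusSource w S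
      - 3 * W.bar * barSource w S - W.lin S * (2 - decel w S) := by
    rw [linRate, mul_sub, mul_div_cancel₀ _ (lin_pos hW hS).ne']
  rw [monotoneRate, mul_add, mul_left_comm (W.lin S), hlin, tildeRate, checkRate, curvRate,
    matterRate, decel_eq hw hS, total]
  ring

namespace IsLyapunov

variable {rest : State → ℝ}

theorem monotoneFn_pos (hW : W.IsLyapunov w rest) (hw : -1 < w) (hS : S ∈ genericRegion) :
    0 < W.monotoneFn w S := by
  have hM := matterDensity_pos hw hS
  have hl := lin_pos hW.normSq_lt_one (genericRegion_subset_physicalRegion hS)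
  obtain ⟨hT, hC, hK, -⟩ := hS
  unfold monotoneFn
  positivity

theorem monotoneFn_nonneg (hW : W.IsLyapunov w rest) (hw : -1 < w) (hS : S ∈ physicalRegion) :
    0 ≤ W.monotoneFn w S := by
  have hM := matterDensity_nonneg hw hS
  have hl := lin_pos hW.normSq_lt_one hS
  obtain ⟨hT, hC, hK, -⟩ := hS
  unfold monotoneFn
  positivity

theorem monotoneRate_nonneg (hW : W.IsLyapunov w rest) (hS : S ∈ stateSpace w) :
    0 ≤ W.monotoneRate w S := by
  obtain ⟨N, hN, hid⟩ := hW.lin_mul_monotoneRate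
  refine nonneg_of_mul_nonneg_right ?_
    (lin_pos hW.normSq_lt_one (stateSpace_subset_physicalRegion hS))
  rw [hid S hS]
  exact add_nonneg (mul_nonneg hN.le (dev_nonneg hW.normSq_lt_one)) (hW.rest_nonneg S hS)

theorem eq_of_monotoneRate_eq_zero (hW : W.IsLyapunov w rest) (hS : S ∈ stateSpace w)
    (h : W.monotoneRate w S = 0) :
    sigPlus S = W.plus ∧ scaledBar S = W.bar ∧ rest S = 0 := by
  obtain ⟨N, hN, hid⟩ := hW.lin_mul_monotoneRate
  have hdev := dev_nonneg hW.normSq_lt_one (S := S)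
  have hsum : N * W.dev S + rest S = 0 := by rw [← hid S hS, h, mul_zero]
  obtain ⟨hdev0, hrest⟩ :=
    (add_eq_zero_iff_of_nonneg (mul_nonneg hN.le hdev) (hW.rest_nonneg S hS)).1 hsum
  obtain ⟨hp, hX⟩ :=
    eq_of_dev_eq_zero hW.normSq_lt_one ((mul_eq_zero.1 hdev0).resolve_left hN.ne')
  exact ⟨hp, hX, hrest⟩

theorem continuousOn_monotoneFn (hW : W.IsLyapunov w rest) (hw : -1 < w) (hw' : w < 1) :
    ContinuousOn (W.monotoneFn w) physicalRegion := by
  have hM := continuousOn_matterDensity hw hw'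
  have hcoord : ∀ i : Fin 6, ContinuousOn (fun S : State => S i) physicalRegion :=
    fun i => (continuous_apply i).continuousOn
  exact (((((hcoord 2).rpow_const fun _ _ => .inr hW.tilde_nonneg).mul
    ((hcoord 3).rpow_const fun _ _ => .inr hW.check_nonneg)).mul
    ((hcoord 4).rpow_const fun _ _ => .inr hW.curv_nonneg)).mul
    (hM.rpow_const fun _ _ => .inr hW.matter_nonneg)).mul
    (continuous_lin.continuousOn.rpow_const fun S hS => .inl (lin_pos hW.normSq_lt_one hS).ne')

theorem continuousOn_monotoneRate (hW : W.IsLyapunov w rest) (hw : -1 < w) :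
    ContinuousOn (W.monotoneRate w) physicalRegion := by
  have hq := continuousOn_decel hw
  have hT := continuousOn_tildeRate hw
  have hC := continuousOn_checkRate hw
  have hK := continuousOn_curvRate hw
  have hplus := continuousOn_plusSource hw
  have hbar := continuousOn_barSource hw
  have hlin : ContinuousOn (W.linRate w) physicalRegion :=
    ((by fun_prop : ContinuousOn (fun S => (2 - decel w S) - W.plus * plusSource w S
      - 3 * W.bar * barSource w S) physicalRegion).div continuous_lin.continuousOn
      fun S hS => (lin_pos hW.normSq_lt_one hS).ne').sub (by fun_prop)
  unfold monotoneRate matterRate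
  fun_prop

theorem hasLogDerivWithinAt_monotoneFn {γ : ℝ → State} {s : Set ℝ} {t : ℝ}
    (hW : W.IsLyapunov w rest) (hw : -1 < w) (hw' : w < 1)
    (h : HasDerivWithinAt γ (field w (γ t)) s t) (ht : γ t ∈ genericRegion) :
    HasLogDerivWithinAt (fun τ => W.monotoneFn w (γ τ)) (W.monotoneRate w (γ t)) s t :=
  have hl := lin_pos hW.normSq_lt_one (genericRegion_subset_physicalRegion ht)
  (((((hasLogDerivWithinAt_sigTildeSq h).rpow_const ht.1).mul
    ((hasLogDerivWithinAt_sigCheckSq h).rpow_const ht.2.1)).mul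
    ((hasLogDerivWithinAt_omK h).rpow_const ht.2.2.1)).mul
    ((hasLogDerivWithinAt_matterDensity hw hw' h ht).rpow_const (matterDensity_pos hw ht))).mul
    ((hasLogDerivWithinAt_lin h hl.ne').rpow_const hl)

end IsLyapunov

/-- The properties shared by all limit points of a solution along which the monotone function
belonging to `W` increases: it is positive and stationary there, and `Σ₊' = Σ̄' = 0`. -/
structure IsTerminal (W : Weights) (w : ℝ) (rest : State → ℝ) (y : State) : Prop where
  neg_one_lt : -1 < w
  lt_one : w < 1
  mem_stateSpace : y ∈ stateSpace w
  sigPlus_eq : sigPlus y = W.plus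
  scaledBar_eq : scaledBar y = W.bar
  rest_eq_zero : rest y = 0
  monotoneFn_pos : 0 < W.monotoneFn w y
  plusSource_eq : plusSource w y = (2 - decel w y) * W.plus
  barSource_eq : barSource w y = (2 - decel w y) * W.bar

end Weights

theorem IsGenOrbit.exists_forall_isTerminal {γ : ℝ → State} {W : Weights} {rest : State → ℝ}
    (hγ : IsGenOrbit w γ) (hW : W.IsLyapunov w rest) :
    ∃ c, ∀ y, MapClusterPt y atTop γ → W.monotoneFn w y = c ∧ W.IsTerminal w rest y := by
  have hw := hγ.neg_one_lt
  have hsub := stateSpace_subset_physicalRegion (w := w)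
  have hcompact := isCompact_stateSpace hw
  have hfn := (hW.continuousOn_monotoneFn hw hγ.lt_one).mono hsub
  have hrate := (hW.continuousOn_monotoneRate hw).mono hsub
  obtain ⟨c, h0c, hc⟩ := exists_forall_mapClusterPt_eq_and_deriv_eq_zero hcompact
    hγ.uniformContinuousOn hγ.mem_stateSpace hfn (hrate.mul hfn)
    (fun t ht => hW.hasLogDerivWithinAt_monotoneFn hw hγ.lt_one (hγ.isIntegralCurveOn t ht)
      (mem_sGen_iff.1 (hγ.mem_sGen ht)).1)
    fun S hS => mul_nonneg (hW.monotoneRate_nonneg hS) (hW.monotoneFn_nonneg hw (hsub hS))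
  have hc0 : 0 < c :=
    (hW.monotoneFn_pos hw (mem_sGen_iff.1 hγ.mem_sGen_zero).1).trans_le h0c
  have hshear : ∀ y, MapClusterPt y atTop γ →
      sigPlus y = W.plus ∧ scaledBar y = W.bar ∧ rest y = 0 := fun y hy => by
    obtain ⟨hval, hzero⟩ := hc y hy
    exact hW.eq_of_monotoneRate_eq_zero (hγ.mem_stateSpace_of_mapClusterPt hy)
      ((mul_eq_zero.1 hzero).resolve_right (hval ▸ hc0.ne'))
  have hplus := (continuousOn_plusSource hw).mono hsub
  have hbar := (continuousOn_barSource hw).mono hsub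
  have hq := (continuousOn_decel hw).mono hsub
  have hX := continuous_scaledBar.continuousOn (s := stateSpace w)
  refine ⟨c, fun y hy => ?_⟩
  obtain ⟨hp, hX0, hrest⟩ := hshear y hy
  have hplus0 := eq_zero_of_mapClusterPt_of_hasDerivWithinAt hcompact hγ.uniformContinuousOn
    hγ.mem_stateSpace (continuous_apply 0).continuousOn
    (g := fun S => -(2 - decel w S) * sigPlus S + plusSource w S) (by fun_prop)
    (fun t ht => hasDerivWithinAt_sigPlus (hγ.isIntegralCurveOn t ht))
    (fun y hy => (hshear y hy).1) hy
  have hbar0 := eq_zero_of_mapClusterPt_of_hasDerivWithinAt hcompact hγ.uniformContinuousOn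
    hγ.mem_stateSpace hX
    (g := fun S => -(2 - decel w S) * scaledBar S + barSource w S) (by fun_prop)
    (fun t ht => hasDerivWithinAt_scaledBar (hγ.isIntegralCurveOn t ht))
    (fun y hy => (hshear y hy).2.1) hy
  rw [hp] at hplus0
  rw [hX0] at hbar0
  exact ⟨(hc y hy).1, hw, hγ.lt_one, hγ.mem_stateSpace_of_mapClusterPt hy, hp, hX0, hrest,
    (hc y hy).1 ▸ hc0, by linarith, by linarith⟩

namespace Weights

namespace IsTerminal

variable {W : Weights} {rest : State → ℝ} {y : State}

theorem mem_physicalRegion (h : W.IsTerminal w rest y) : y ∈ physicalRegion :=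
  stateSpace_subset_physicalRegion h.mem_stateSpace

theorem sigTildeSq_pos (h : W.IsTerminal w rest y) (hpos : 0 < W.tilde) : 0 < sigTildeSq y :=
  h.mem_physicalRegion.1.lt_of_ne' fun h0 => h.monotoneFn_pos.ne' <| by
    rw [monotoneFn, h0, Real.zero_rpow hpos.ne']
    simp only [zero_mul]

theorem sigCheckSq_pos (h : W.IsTerminal w rest y) (hpos : 0 < W.check) : 0 < sigCheckSq y :=
  h.mem_physicalRegion.2.1.lt_of_ne' fun h0 => h.monotoneFn_pos.ne' <| by
    rw [monotoneFn, h0, Real.zero_rpow hpos.ne']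
    simp only [zero_mul, mul_zero]

theorem omK_pos (h : W.IsTerminal w rest y) (hpos : 0 < W.curv) : 0 < omK y :=
  h.mem_physicalRegion.2.2.1.lt_of_ne' fun h0 => h.monotoneFn_pos.ne' <| by
    rw [monotoneFn, h0, Real.zero_rpow hpos.ne']
    simp only [zero_mul, mul_zero]

theorem matterDensity_ne_zero (h : W.IsTerminal w rest y) (hpos : 0 < W.matter) :
    matterDensity w y ≠ 0 := fun h0 => h.monotoneFn_pos.ne' <| by
  rw [monotoneFn, h0, Real.zero_rpow hpos.ne']
  simp only [zero_mul, mul_zero]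

theorem omDivG_pos (h : W.IsTerminal w rest y) (hpos : 0 < W.matter) : 0 < omDivG w y :=
  (omDivG_nonneg h.neg_one_lt h.mem_physicalRegion).lt_of_ne'
    (mul_ne_zero_iff.1 (h.matterDensity_ne_zero hpos)).1

theorem vSq_lt_one (h : W.IsTerminal w rest y) (hpos : 0 < W.matter) : vSq y < 1 :=
  h.mem_physicalRegion.2.2.2.2.1.lt_of_ne fun h1 => h.matterDensity_ne_zero hpos <| by
    have hexp : (1 - w) / 2 ≠ 0 := (half_pos (sub_pos.2 h.lt_one)).ne'
    rw [matterDensity, h1, sub_self, Real.zero_rpow hexp, mul_zero]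

theorem sigBar_eq (h : W.IsTerminal w rest y) : sigBar y = √3 * W.bar := by
  rw [TiltedBianchiII.sigBar_eq, h.scaledBar_eq]

theorem gauss_constraint (h : W.IsTerminal w rest y) :
    W.plus ^ 2 + 3 * W.bar ^ 2 + sigTildeSq y + sigCheckSq y + omK y + omDivG w y
      + w * (vSq y * omDivG w y) = 1 := by
  rw [← h.sigPlus_eq, ← h.scaledBar_eq]
  linear_combination TiltedBianchiII.gauss_constraint h.neg_one_lt h.mem_physicalRegion

theorem two_sub_decel (h : W.IsTerminal w rest y) :
    2 - decel w y = 2 * omK y + 3 / 2 * (1 - w) * omDivG w y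
      + 1 / 2 * (5 * w - 1) * (vSq y * omDivG w y) := by
  rw [decel_eq h.neg_one_lt h.mem_physicalRegion]
  ring

theorem plus_balance (h : W.IsTerminal w rest y) :
    -3 * sigCheckSq y + 4 * omK y + 1 / 2 * (1 + w) * (vSq y * omDivG w y)
      = (2 - decel w y) * W.plus := by
  rw [← h.plusSource_eq, plusSource]
  ring

theorem bar_balance (h : W.IsTerminal w rest y) :
    -2 * sigTildeSq y + sigCheckSq y + 1 / 2 * (1 + w) * (vSq y * omDivG w y)
      = (2 - decel w y) * W.bar := by
  rw [← h.barSource_eq, barSource]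
  ring

end IsTerminal

end Weights

theorem IsGenOrbit.omegaSet_eq_singleton_of_isLyapunov {γ : ℝ → State} {W : Weights}
    {rest : State → ℝ} {p : State} (hγ : IsGenOrbit w γ) (hW : W.IsLyapunov w rest)
    (h : ∀ y, W.IsTerminal w rest y → y = p) : omegaSet γ = {p} :=
  have ⟨_, hc⟩ := hγ.exists_forall_isTerminal hW
  hγ.omegaSet_eq_singleton fun y hy => h y (hc y hy).2

theorem eq_vec {y : State} {a b c d e f : ℝ} (ha : sigPlus y = a) (hb : sigBar y = b)
    (hc : sigTildeSq y = c) (hd : sigCheckSq y = d) (he : omK y = e) (hf : vSq y = f) :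
    y = ![a, b, c, d, e, f] := by
  subst ha hb hc hd he hf
  funext i
  fin_cases i <;> rfl

theorem vSq_mul_omDivG_nonneg (hw : -1 < w) (hS : S ∈ physicalRegion) :
    0 ≤ vSq S * omDivG w S :=
  mul_nonneg hS.2.2.2.1 (omDivG_nonneg hw hS)

/-- The weights belonging to the Friedmann point. -/
def friedmannWeights : Weights := ⟨0, 0, 0, 1, 0, 0⟩

/-- The remainder in the monotonicity identity for `friedmannWeights`. -/
def friedmannRest (w : ℝ) (S : State) : ℝ :=
  3 * (1 - w) * (sigTildeSq S + sigCheckSq S) + (-1 - 3 * w) * omK S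
    + (1 - 3 * w) * (1 + w) * (vSq S * omDivG w S)

theorem isLyapunov_friedmannWeights (hw : -1 < w) (h : w ≤ -1 / 3) :
    friedmannWeights.IsLyapunov w (friedmannRest w) := by
  have hnorm : friedmannWeights.normSq < 1 := by norm_num [Weights.normSq, friedmannWeights]
  refine ⟨le_rfl, le_rfl, le_rfl, zero_le_one, hnorm, fun S hS => ?_, 3 * (1 - w), by linarith,
    fun S hS => ?_⟩
  · have hV := vSq_mul_omDivG_nonneg hw (stateSpace_subset_physicalRegion hS)
    obtain ⟨-, hT, hC, hK, -⟩ := hS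
    have h1 : 0 ≤ 1 - w := by linarith
    have h2 : 0 ≤ -1 - 3 * w := by linarith
    have h3 : 0 ≤ 1 - 3 * w := by linarith
    have h4 : 0 ≤ 1 + w := by linarith
    unfold friedmannRest
    positivity
  · have hS' := stateSpace_subset_physicalRegion hS
    rw [Weights.lin_mul_monotoneRate_eq hnorm hw hS', plusSource, barSource]
    simp only [Weights.dev, Weights.normSq, Weights.total, Weights.lin, friedmannWeights,
      friedmannRest]
    linear_combination (-3 * (1 - w)) * gauss_constraint hw hS'

theorem eq_ptF_of_isTerminal {y : State} (h : w ≤ -1 / 3)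
    (hy : friedmannWeights.IsTerminal w (friedmannRest w) y) : y = ptF := by
  have hw := hy.neg_one_lt
  have hU : 0 < omDivG w y := hy.omDivG_pos one_pos
  have hV := vSq_mul_omDivG_nonneg hw hy.mem_physicalRegion
  obtain ⟨hT, hC, hK, -⟩ := hy.mem_physicalRegion
  have hcoeff : 0 < (1 - 3 * w) * (1 + w) := mul_pos (by linarith) (by linarith)
  have hrest := hy.rest_eq_zero
  unfold friedmannRest at hrest
  obtain ⟨hTCK, hV0⟩ := (add_eq_zero_iff_of_nonneg
    (add_nonneg (mul_nonneg (by linarith) (add_nonneg hT hC)) (mul_nonneg (by linarith) hK))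
    (mul_nonneg hcoeff.le hV)).1 hrest
  obtain ⟨hTC, -⟩ := (add_eq_zero_iff_of_nonneg
    (mul_nonneg (by linarith) (add_nonneg hT hC)) (mul_nonneg (by linarith) hK)).1 hTCK
  obtain ⟨hT0, hC0⟩ := (add_eq_zero_iff_of_nonneg hT hC).1
    ((mul_eq_zero.1 hTC).resolve_left (by linarith))
  replace hV0 := (mul_eq_zero.1 hV0).resolve_left hcoeff.ne'
  have hK0 : omK y = 0 := by
    have hbal := hy.plus_balance
    rw [hC0, hV0, show friedmannWeights.plus = 0 from rfl] at hbal
    linarith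
  exact eq_vec hy.sigPlus_eq (hy.sigBar_eq.trans (mul_zero _)) hT0 hC0 hK0
    ((mul_eq_zero.1 hV0).resolve_right hU.ne')

/-- The weights belonging to the Collins–Stewart point. -/
def collinsStewartWeights (w : ℝ) : Weights :=
  ⟨0, 0, (3 * w + 1) * (1 - w), 4 * (5 - w), (3 * w + 1) / 8, 0⟩

/-- The remainder in the monotonicity identity for `collinsStewartWeights`. -/
def collinsStewartRest (w : ℝ) (S : State) : ℝ :=
  2 * (21 - 2 * w - 3 * w ^ 2) * (3 / 2 * (1 - w) * sigTildeSq S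
    + 3 / 8 * (3 - 7 * w) * sigCheckSq S
    + 3 / 16 * (3 - 7 * w) * (1 + w) * (vSq S * omDivG w S))

theorem isLyapunov_collinsStewartWeights (h1 : -1 / 3 < w) (h2 : w ≤ 3 / 7) :
    (collinsStewartWeights w).IsLyapunov w (collinsStewartRest w) := by
  have hw : -1 < w := by linarith
  have hnorm : (collinsStewartWeights w).normSq < 1 := by
    simp only [Weights.normSq, collinsStewartWeights]
    nlinarith
  refine ⟨le_rfl, le_rfl, mul_nonneg (by linarith) (by linarith),
    mul_nonneg (by norm_num) (by linarith), hnorm, fun S hS => ?_, 64 * (1 - w), by linarith,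
    fun S hS => ?_⟩
  · have hV := vSq_mul_omDivG_nonneg hw (stateSpace_subset_physicalRegion hS)
    obtain ⟨-, hT, hC, -⟩ := hS
    have h21 : 0 ≤ 21 - 2 * w - 3 * w ^ 2 := by nlinarith
    have h3 : 0 ≤ 1 - w := by linarith
    have h4 : 0 ≤ 3 - 7 * w := by linarith
    have h5 : 0 ≤ 1 + w := by linarith
    unfold collinsStewartRest
    positivity
  · have hS' := stateSpace_subset_physicalRegion hS
    rw [Weights.lin_mul_monotoneRate_eq hnorm hw hS', plusSource, barSource]
    simp only [Weights.dev, Weights.normSq, Weights.total, Weights.lin, collinsStewartWeights,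
      collinsStewartRest]
    linear_combination (-3 * (1 - w) * (21 - 2 * w - 3 * w ^ 2)) * gauss_constraint hw hS'

theorem eq_ptCS_of_isTerminal {y : State} (h1 : -1 / 3 < w) (h2 : w ≤ 3 / 7)
    (hy : (collinsStewartWeights w).IsTerminal w (collinsStewartRest w) y) : y = ptCS w := by
  have hU : 0 < omDivG w y := hy.omDivG_pos (mul_pos (by norm_num) (by linarith))
  have hV := vSq_mul_omDivG_nonneg hy.neg_one_lt hy.mem_physicalRegion
  obtain ⟨hT, hC, -⟩ := hy.mem_physicalRegion
  have hp : (collinsStewartWeights w).plus = (3 * w + 1) / 8 := rfl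
  have hX : (collinsStewartWeights w).bar = 0 := rfl
  have hT0 : sigTildeSq y = 0 := by
    have hrest := (mul_eq_zero.1 hy.rest_eq_zero).resolve_left (by nlinarith)
    have hC' : 0 ≤ 3 / 8 * (3 - 7 * w) * sigCheckSq y := mul_nonneg (by linarith) hC
    have hV' : 0 ≤ 3 / 16 * (3 - 7 * w) * (1 + w) * (vSq y * omDivG w y) :=
      mul_nonneg (mul_nonneg (by linarith) (by linarith)) hV
    exact le_antisymm (nonpos_of_mul_nonpos_right (b := sigTildeSq y)
      (a := 3 / 2 * (1 - w)) (by linarith) (by linarith)) hT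
  obtain ⟨hC0, hV0⟩ : sigCheckSq y = 0 ∧ vSq y * omDivG w y = 0 := by
    have hbal := hy.bar_balance
    rw [hT0, hX, mul_zero, mul_zero, zero_add] at hbal
    obtain ⟨hC0, hV0⟩ :=
      (add_eq_zero_iff_of_nonneg hC (mul_nonneg (by linarith) hV)).1 hbal
    exact ⟨hC0, (mul_eq_zero.1 hV0).resolve_left (by linarith)⟩
  have hK0 : omK y = 3 / 64 * (3 * w + 1) * (1 - w) := by
    have hG := hy.gauss_constraint
    have hbal := hy.plus_balance
    rw [hp, hX, hT0, hC0, hV0] at hG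
    rw [hy.two_sub_decel, hp, hC0, hV0] at hbal
    have hfac : 4 * (1 - ((3 * w + 1) / 8) ^ 2) *
        (omK y - 3 / 64 * (3 * w + 1) * (1 - w)) = 0 := by
      linear_combination hbal + 3 / 2 * (1 - w) * ((3 * w + 1) / 8) * hG
    exact sub_eq_zero.1 ((mul_eq_zero.1 hfac).resolve_left (by nlinarith))
  refine eq_vec hy.sigPlus_eq ?_ hT0 hC0 hK0 ((mul_eq_zero.1 hV0).resolve_right hU.ne')
  rw [hy.sigBar_eq, hX, mul_zero]

/-- The weights belonging to Hewitt's point; at `w = 5 / 9` all points of the line `HL` share them.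
The exponents are scaled so that at `w = 5 / 9` their sum is the same as for `extremeWeights`. -/
def hewittWeights (w : ℝ) : Weights :=
  ⟨0, 9 / 4 * (7 * w - 3), 9 / 2 * (3 * w - 1), 18, (3 * w + 1) / 8, (7 * w - 3) / 8⟩

/-- The remainder in the monotonicity identity for `hewittWeights`. -/
def hewittRest (w : ℝ) (S : State) : ℝ :=
  27 / 8 * (13 * w + 3) * ((5 - 9 * w) * sigTildeSq S)

theorem isLyapunov_hewittWeights (h1 : 3 / 7 < w) (h2 : w ≤ 5 / 9) :
    (hewittWeights w).IsLyapunov w (hewittRest w) := by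
  have hw : -1 < w := by linarith
  have hnorm : (hewittWeights w).normSq < 1 := by
    simp only [Weights.normSq, hewittWeights]
    nlinarith
  refine ⟨le_rfl, mul_nonneg (by norm_num) (by linarith), mul_nonneg (by norm_num) (by linarith),
    by norm_num [hewittWeights], hnorm, fun S hS => ?_, 36, by norm_num, fun S hS => ?_⟩
  · exact mul_nonneg (by linarith) (mul_nonneg (by linarith) hS.2.1)
  · have hS' := stateSpace_subset_physicalRegion hS
    rw [Weights.lin_mul_monotoneRate_eq hnorm hw hS', plusSource, barSource]
    simp only [Weights.dev, Weights.normSq, Weights.total, Weights.lin, hewittWeights, hewittRest]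
    linear_combination (-27 / 4 * (1 - w) * (13 * w + 3)) * gauss_constraint hw hS'

section Hewitt

variable {y : State}

theorem sub_mul_sigTildeSq_eq_zero (h : 3 / 7 < w)
    (hy : (hewittWeights w).IsTerminal w (hewittRest w) y) : (5 - 9 * w) * sigTildeSq y = 0 :=
  (mul_eq_zero.1 hy.rest_eq_zero).resolve_left (by linarith)

theorem two_sub_decel_of_isTerminal_hewittWeights (h : 3 / 7 < w)
    (hy : (hewittWeights w).IsTerminal w (hewittRest w) y) :
    2 - decel w y = 3 / 2 * (1 - w) := by
  have hT := sub_mul_sigTildeSq_eq_zero h hy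
  have hplus := hy.plus_balance
  have hbar := hy.bar_balance
  have hG := hy.gauss_constraint
  have hq := hy.two_sub_decel
  simp only [hewittWeights] at hplus hbar hG
  have hfac : (1 - w) * (13 * w + 3) * ((2 - decel w y) - 3 / 2 * (1 - w)) = 0 := by
    linear_combination 2 / 3 * (3 * w + 1) * hplus + 2 * (7 * w - 3) * hbar
      + 8 * (1 - w) * hG + 16 / 3 * hq - 4 * hT
  have hpos : 0 < (1 - w) * (13 * w + 3) := mul_pos (by linarith [hy.lt_one]) (by linarith)
  exact sub_eq_zero.1 ((mul_eq_zero.1 hfac).resolve_left hpos.ne')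

theorem sigCheckSq_of_isTerminal_hewittWeights (h : 3 / 7 < w)
    (hy : (hewittWeights w).IsTerminal w (hewittRest w) y) :
    sigCheckSq y = 3 / 16 * (1 - w) * (7 * w - 3) + 2 * sigTildeSq y
      - 1 / 2 * (1 + w) * (vSq y * omDivG w y) := by
  have hbar := hy.bar_balance
  rw [two_sub_decel_of_isTerminal_hewittWeights h hy, hewittWeights] at hbar
  linear_combination hbar

theorem omK_of_isTerminal_hewittWeights (h : 3 / 7 < w)
    (hy : (hewittWeights w).IsTerminal w (hewittRest w) y) :
    omK y = 3 / 8 * (1 - w) * (3 * w - 1) + 3 / 2 * sigTildeSq y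
      - 1 / 2 * (1 + w) * (vSq y * omDivG w y) := by
  have hplus := hy.plus_balance
  rw [two_sub_decel_of_isTerminal_hewittWeights h hy, hewittWeights] at hplus
  linear_combination 1 / 4 * hplus + 3 / 4 * sigCheckSq_of_isTerminal_hewittWeights h hy

theorem omDivG_of_isTerminal_hewittWeights (h : 3 / 7 < w)
    (hy : (hewittWeights w).IsTerminal w (hewittRest w) y) :
    omDivG w y = 3 / 2 * (1 - w) - 9 / 2 * sigTildeSq y + vSq y * omDivG w y := by
  have hG := hy.gauss_constraint
  simp only [hewittWeights] at hG
  linear_combination hG - sigCheckSq_of_isTerminal_hewittWeights h hy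
    - omK_of_isTerminal_hewittWeights h hy

/-- The Codazzi constraint is linear in `v² Ω / G₊` here, since its quadratic terms cancel. -/
theorem mul_vSq_mul_omDivG_of_isTerminal_hewittWeights (h : 3 / 7 < w)
    (hy : (hewittWeights w).IsTerminal w (hewittRest w) y) :
    3 / 8 * (1 - w) * (1 + w) * (17 * w - 1) * (vSq y * omDivG w y)
      = 4 * (3 / 16 * (1 - w) * (7 * w - 3) + 2 * sigTildeSq y)
        * (3 / 8 * (1 - w) * (3 * w - 1) + 3 / 2 * sigTildeSq y) := by
  have hcod : 4 * sigCheckSq y * omK y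
      = (1 + w) ^ 2 * (vSq y * omDivG w y) * omDivG w y := by
    rw [codazzi_constraint hy.mem_stateSpace]
    ring
  have hT := sub_mul_sigTildeSq_eq_zero h hy
  have hU := omDivG_of_isTerminal_hewittWeights h hy
  rw [sigCheckSq_of_isTerminal_hewittWeights h hy, omK_of_isTerminal_hewittWeights h hy] at hcod
  linear_combination -hcod - (1 + w) ^ 2 * (vSq y * omDivG w y) * hU
    - 1 / 2 * (1 + w) * (vSq y * omDivG w y) * hT

theorem eq_ptH_of_isTerminal (h1 : 3 / 7 < w) (h2 : w < 5 / 9)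
    (hy : (hewittWeights w).IsTerminal w (hewittRest w) y) : y = ptH w := by
  have hT : sigTildeSq y = 0 :=
    (mul_eq_zero.1 (sub_mul_sigTildeSq_eq_zero h1 hy)).resolve_left (by linarith)
  have hC := sigCheckSq_of_isTerminal_hewittWeights h1 hy
  have hK := omK_of_isTerminal_hewittWeights h1 hy
  have hU := omDivG_of_isTerminal_hewittWeights h1 hy
  have hcod := mul_vSq_mul_omDivG_of_isTerminal_hewittWeights h1 hy
  rw [hT] at hC hK hU hcod
  have hw1 : 1 - w ≠ 0 := by linarith
  have hV : (1 + w) * (17 * w - 1) * (vSq y * omDivG w y)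
      = 3 / 4 * (1 - w) * (7 * w - 3) * (3 * w - 1) := by
    refine mul_left_cancel₀ (mul_ne_zero (by norm_num : (3 / 8 : ℝ) ≠ 0) hw1) ?_
    linear_combination hcod
  have h17 : 17 * w - 1 ≠ 0 := by linarith
  have h11 : 11 * w + 1 ≠ 0 := by linarith
  have h5 : 5 * w + 1 ≠ 0 := by linarith
  refine eq_vec hy.sigPlus_eq ?_ hT ?_ ?_ ?_
  · rw [hy.sigBar_eq, hewittWeights]
    ring
  · rw [eq_div_iff (mul_ne_zero (by norm_num) h17)]
    linear_combination 16 * (17 * w - 1) * hC - 8 * hV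
  · rw [eq_div_iff (mul_ne_zero (by norm_num) h17)]
    linear_combination 4 * (17 * w - 1) * hK - 2 * hV
  · have hU' : (1 + w) * (17 * w - 1) * omDivG w y
        = 3 / 4 * (1 - w) * (11 * w + 1) * (5 * w + 1) := by
      linear_combination (1 + w) * (17 * w - 1) * hU + hV
    rw [eq_div_iff (mul_ne_zero h11 h5)]
    refine mul_left_cancel₀ (mul_ne_zero (by norm_num : (3 / 4 : ℝ) ≠ 0) hw1) ?_
    linear_combination (-vSq y) * hU' + hV

end Hewitt

/-- The weights belonging to the extremely tilted point. -/
def extremeWeights : Weights := ⟨4, 10, 9, 0, 1 / 3, 1 / 9⟩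

/-- The remainder in the monotonicity identity for `extremeWeights`. -/
def extremeRest (w : ℝ) (S : State) : ℝ :=
  23 / 3 * (9 * w - 5) * ((1 - vSq S) * omDivG w S)

theorem isLyapunov_extremeWeights (h : 5 / 9 ≤ w) :
    extremeWeights.IsLyapunov w (extremeRest w) := by
  have hw : -1 < w := by linarith
  have hnorm : extremeWeights.normSq < 1 := by norm_num [Weights.normSq, extremeWeights]
  refine ⟨by norm_num [extremeWeights], by norm_num [extremeWeights],
    by norm_num [extremeWeights], le_rfl, hnorm, fun S hS => ?_, 36, by norm_num, fun S hS => ?_⟩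
  · have hS' := stateSpace_subset_physicalRegion hS
    exact mul_nonneg (by linarith)
      (mul_nonneg (sub_nonneg.2 hS'.2.2.2.2.1) (omDivG_nonneg hw hS'))
  · have hS' := stateSpace_subset_physicalRegion hS
    rw [Weights.lin_mul_monotoneRate_eq hnorm hw hS', plusSource, barSource]
    simp only [Weights.dev, Weights.normSq, Weights.total, Weights.lin, extremeWeights,
      extremeRest]
    linear_combination (-92 / 3) * gauss_constraint hw hS'

theorem sqrt_three_mul_ninth : √3 * (1 / 9) = 1 / (3 * √3) := by
  have h3 : √3 * √3 = 3 := Real.mul_self_sqrt (by norm_num)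
  rw [eq_div_iff (by positivity)]
  linear_combination (1 / 3) * h3

theorem vSq_eq_one_of_isTerminal_extremeWeights {y : State} (h : 5 / 9 < w)
    (hy : extremeWeights.IsTerminal w (extremeRest w) y) : vSq y = 1 := by
  have hC : 0 < sigCheckSq y := hy.sigCheckSq_pos (by norm_num [extremeWeights])
  have hK : 0 < omK y := hy.omK_pos (by norm_num [extremeWeights])
  have hU : omDivG w y ≠ 0 := fun h0 => by
    have hcod := codazzi_constraint hy.mem_stateSpace
    rw [h0, zero_pow two_ne_zero, mul_zero] at hcod
    exact (by positivity : 4 * sigCheckSq y * omK y ≠ 0) hcod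
  have hprod := (mul_eq_zero.1 hy.rest_eq_zero).resolve_left (by linarith)
  exact (sub_eq_zero.1 ((mul_eq_zero.1 hprod).resolve_right hU)).symm

theorem eq_ptHet_of_isTerminal {y : State} (h : 5 / 9 < w)
    (hy : extremeWeights.IsTerminal w (extremeRest w) y) : y = ptHet := by
  have hw := hy.neg_one_lt
  have hK : 0 < omK y := hy.omK_pos (by norm_num [extremeWeights])
  have hv := vSq_eq_one_of_isTerminal_extremeWeights h hy
  have hY : 0 ≤ (1 + w) * omDivG w y :=
    mul_nonneg (by linarith) (omDivG_nonneg hw hy.mem_physicalRegion)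
  have hcod := codazzi_constraint hy.mem_stateSpace
  have hG := hy.gauss_constraint
  have hplus := hy.plus_balance
  have hbar := hy.bar_balance
  rw [hy.two_sub_decel] at hplus hbar
  simp only [hv, extremeWeights] at hcod hG hplus hbar
  have hC : 18 * sigCheckSq y = 20 * omK y + (1 + w) * omDivG w y := by
    linear_combination -6 * hplus
  have hT : 36 * sigTildeSq y = 16 * omK y + 8 * ((1 + w) * omDivG w y) := by
    linear_combination -18 * hbar + hC
  have hY0 : (1 + w) * omDivG w y = 20 / 9 * omK y := by
    have hfac : (20 * omK y - 9 * ((1 + w) * omDivG w y))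
        * (2 * omK y + (1 + w) * omDivG w y) = 0 := by
      linear_combination 9 * hcod - 2 * omK y * hC
    have hzero := (mul_eq_zero.1 hfac).resolve_right (by linarith)
    linarith
  have hK0 : omK y = 3 / 19 := by linarith
  exact eq_vec hy.sigPlus_eq (hy.sigBar_eq.trans sqrt_three_mul_ninth) (by linarith [hT])
    (by linarith [hC]) hK0 hv

theorem exists_eq_ptHL_of_isTerminal {y : State}
    (hy : (hewittWeights (5 / 9)).IsTerminal (5 / 9) (hewittRest (5 / 9)) y)
    (hT : 0 < sigTildeSq y) :
    ∃ b ∈ Ioo (0 : ℝ) 1, y = ptHL b ∧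
      omDivG (5 / 9) y = 2 * (17 - 8 * b) * (8 - 3 * b) / 399 := by
  have h37 : (3 / 7 : ℝ) < 5 / 9 := by norm_num
  have hU : 0 < omDivG (5 / 9) y := hy.omDivG_pos (by norm_num [hewittWeights])
  have hv : vSq y < 1 := hy.vSq_lt_one (by norm_num [hewittWeights])
  have hCV := sigCheckSq_of_isTerminal_hewittWeights h37 hy
  have hKV := omK_of_isTerminal_hewittWeights h37 hy
  have hUV := omDivG_of_isTerminal_hewittWeights h37 hy
  have hcod := mul_vSq_mul_omDivG_of_isTerminal_hewittWeights h37 hy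
  obtain ⟨b, hb⟩ : ∃ b, sigTildeSq y = 4 / 27 * b := ⟨27 / 4 * sigTildeSq y, by ring⟩
  have hb0 : 0 < b := by linarith
  have hb1 : b < 1 := by linarith [mul_lt_of_lt_one_left hU hv]
  rw [hb] at hCV hKV hUV hcod
  have hV : vSq y * omDivG (5 / 9) y = 2 * (4 * b + 1) * (2 * b + 1) / 133 := by linarith
  rw [hV] at hCV hKV hUV
  have hUb : omDivG (5 / 9) y = 2 * (17 - 8 * b) * (8 - 3 * b) / 399 := by
    linear_combination hUV
  have h17 : 0 < 17 - 8 * b := by linarith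
  have h8 : 0 < 8 - 3 * b := by linarith
  refine ⟨b, ⟨hb0, hb1⟩, eq_vec ?_ ?_ hb ?_ ?_ ?_, hUb⟩
  · rw [hy.sigPlus_eq, hewittWeights]
    norm_num
  · rw [hy.sigBar_eq, ← sqrt_three_mul_ninth, hewittWeights]
    norm_num
  · linear_combination hCV
  · linear_combination hKV
  · rw [eq_div_iff (by positivity)]
    rw [hUb] at hV
    linear_combination 399 / 2 * hV

/-- The ratio of the monotone functions of `hewittWeights` and `extremeWeights` on the line `HL`. -/
def lineRatio (b : ℝ) : ℝ :=
  (9 / 2 * ((1 - b) / b)) ^ 4 * (9 / 14 * ((17 - 8 * b) / (4 * b + 1))) ^ 8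
    * (6 / 7 * ((8 - 3 * b) / (2 * b + 1))) ^ 6

theorem strictAntiOn_lineRatio : StrictAntiOn lineRatio (Ioo 0 1) := by
  rintro b ⟨hb, -⟩ c ⟨-, hc⟩ hbc
  have h2 : 0 < 17 - 8 * c := by linarith
  have h3 : 0 < 8 - 3 * c := by linarith
  have h4 : 0 < c := by linarith
  unfold lineRatio
  gcongr <;> linarith

theorem monotoneFn_hewittWeights (S : State) :
    (hewittWeights (5 / 9)).monotoneFn (5 / 9) S = sigCheckSq S ^ 2 * omK S ^ 3
      * matterDensity (5 / 9) S ^ 18 * extremeWeights.lin S ^ (-46 : ℝ) := by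
  have hlin : (hewittWeights (5 / 9)).lin S = extremeWeights.lin S := by
    simp only [Weights.lin, hewittWeights, extremeWeights]
    norm_num
  have hC : 9 / 4 * (7 * (5 / 9) - 3) = (2 : ℝ) := by norm_num
  have hK : 9 / 2 * (3 * (5 / 9) - 1) = (3 : ℝ) := by norm_num
  rw [Weights.monotoneFn, hlin]
  simp only [Weights.total, hewittWeights, hC, hK, Real.rpow_zero, Real.rpow_ofNat, one_mul]
  norm_num

theorem monotoneFn_extremeWeights (w : ℝ) (S : State) :
    extremeWeights.monotoneFn w S = sigTildeSq S ^ 4 * sigCheckSq S ^ 10 * omK S ^ 9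
      * extremeWeights.lin S ^ (-46 : ℝ) := by
  rw [Weights.monotoneFn]
  simp only [Weights.total, extremeWeights, Real.rpow_zero, Real.rpow_ofNat, mul_one]
  norm_num

theorem matterDensity_pow_eighteen (hv : vSq S ≤ 1) :
    matterDensity (5 / 9) S ^ 18
      = (omDivG (5 / 9) S * (1 - vSq S)) ^ 4 * omDivG (5 / 9) S ^ 14 := by
  have hpow : ((1 - vSq S) ^ ((1 - 5 / 9) / 2 : ℝ)) ^ 18 = (1 - vSq S) ^ 4 := by
    rw [← Real.rpow_mul_natCast (sub_nonneg.2 hv), ← Real.rpow_natCast _ 4]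
    norm_num
  rw [matterDensity, mul_pow, hpow]
  ring

theorem matterDensity_pow_eighteen_ptHL {b : ℝ} (hb : b ∈ Ioo (0 : ℝ) 1) (hv : vSq (ptHL b) ≤ 1)
    (hU : omDivG (5 / 9) (ptHL b) = 2 * (17 - 8 * b) * (8 - 3 * b) / 399) :
    matterDensity (5 / 9) (ptHL b) ^ 18
      = lineRatio b * (sigTildeSq (ptHL b) ^ 4 * sigCheckSq (ptHL b) ^ 8 * omK (ptHL b) ^ 6) := by
  obtain ⟨hb0, hb1⟩ := hb
  have h17 : 17 - 8 * b ≠ 0 := by linarith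
  have h8 : 8 - 3 * b ≠ 0 := by linarith
  have hvline : (17 - 8 * b) * (8 - 3 * b) * (1 - vSq (ptHL b)) = 133 * (1 - b) := by
    change (17 - 8 * b) * (8 - 3 * b)
      * (1 - 3 * (4 * b + 1) * (2 * b + 1) / ((17 - 8 * b) * (8 - 3 * b))) = _
    rw [mul_sub, mul_one, mul_div_cancel₀ _ (mul_ne_zero h17 h8)]
    ring
  have hUT : omDivG (5 / 9) (ptHL b) * (1 - vSq (ptHL b))
      = 9 / 2 * ((1 - b) / b) * sigTildeSq (ptHL b) := by
    have htilde : 9 / 2 * ((1 - b) / b) * (4 / 27 * b) = 2 / 3 * (1 - b) := by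
      field_simp
      norm_num
    rw [hU]
    exact (by linear_combination 2 / 399 * hvline : _ = 2 / 3 * (1 - b)).trans htilde.symm
  have hUC : omDivG (5 / 9) (ptHL b)
      = 9 / 14 * ((17 - 8 * b) / (4 * b + 1)) * sigCheckSq (ptHL b) := by
    rw [hU]
    simp only [ptHL, Matrix.cons_val]
    field_simp
    ring
  have hUK : omDivG (5 / 9) (ptHL b)
      = 6 / 7 * ((8 - 3 * b) / (2 * b + 1)) * omK (ptHL b) := by
    rw [hU]
    simp only [ptHL, Matrix.cons_val]
    field_simp
    ring
  rw [matterDensity_pow_eighteen hv, pow_add _ 8 6, hUT]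
  nth_rw 1 [hUC]
  rw [hUK, lineRatio]
  ring

theorem monotoneFn_hewittWeights_ptHL {b : ℝ} (hb : b ∈ Ioo (0 : ℝ) 1) (hv : vSq (ptHL b) ≤ 1)
    (hU : omDivG (5 / 9) (ptHL b) = 2 * (17 - 8 * b) * (8 - 3 * b) / 399) :
    (hewittWeights (5 / 9)).monotoneFn (5 / 9) (ptHL b)
      = lineRatio b * extremeWeights.monotoneFn (5 / 9) (ptHL b) := by
  rw [monotoneFn_hewittWeights, monotoneFn_extremeWeights,
    matterDensity_pow_eighteen_ptHL hb hv hU]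
  ring

theorem IsGenOrbit.omegaSet_eq_ptF {γ : ℝ → State} (hγ : IsGenOrbit w γ) (h : w ≤ -1 / 3) :
    omegaSet γ = {ptF} :=
  hγ.omegaSet_eq_singleton_of_isLyapunov (isLyapunov_friedmannWeights hγ.neg_one_lt h)
    fun _ => eq_ptF_of_isTerminal h

theorem IsGenOrbit.omegaSet_eq_ptCS {γ : ℝ → State} (hγ : IsGenOrbit w γ) (h1 : -1 / 3 < w)
    (h2 : w ≤ 3 / 7) : omegaSet γ = {ptCS w} :=
  hγ.omegaSet_eq_singleton_of_isLyapunov (isLyapunov_collinsStewartWeights h1 h2)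
    fun _ => eq_ptCS_of_isTerminal h1 h2

theorem IsGenOrbit.omegaSet_eq_ptH {γ : ℝ → State} (hγ : IsGenOrbit w γ) (h1 : 3 / 7 < w)
    (h2 : w < 5 / 9) : omegaSet γ = {ptH w} :=
  hγ.omegaSet_eq_singleton_of_isLyapunov (isLyapunov_hewittWeights h1 h2.le)
    fun _ => eq_ptH_of_isTerminal h1 h2

theorem IsGenOrbit.omegaSet_eq_ptHet {γ : ℝ → State} (hγ : IsGenOrbit w γ) (h : 5 / 9 < w) :
    omegaSet γ = {ptHet} :=
  hγ.omegaSet_eq_singleton_of_isLyapunov (isLyapunov_extremeWeights h.le)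
    fun _ => eq_ptHet_of_isTerminal h

theorem IsGenOrbit.exists_forall_eq_ptHL {γ : ℝ → State} (hγ : IsGenOrbit (5 / 9) γ) :
    ∃ r, ∀ y, MapClusterPt y atTop γ → ∃ b ∈ Ioo (0 : ℝ) 1, y = ptHL b ∧ lineRatio b = r := by
  obtain ⟨c, hc⟩ :=
    hγ.exists_forall_isTerminal (isLyapunov_hewittWeights (by norm_num) le_rfl)
  obtain ⟨d, hd⟩ := hγ.exists_forall_isTerminal (isLyapunov_extremeWeights le_rfl)
  refine ⟨c / d, fun y hy => ?_⟩
  obtain ⟨hyc, hterm⟩ := hc y hy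
  obtain ⟨hyd, hterm'⟩ := hd y hy
  obtain ⟨b, hb, rfl, hU⟩ := exists_eq_ptHL_of_isTerminal hterm
    (hterm'.sigTildeSq_pos (by norm_num [extremeWeights]))
  refine ⟨b, hb, rfl, eq_div_of_mul_eq (hyd ▸ hterm'.monotoneFn_pos.ne') ?_⟩
  rw [← hyc, ← hyd, monotoneFn_hewittWeights_ptHL hb hterm.mem_physicalRegion.2.2.2.2.1 hU]

theorem IsGenOrbit.exists_omegaSet_eq_ptHL {γ : ℝ → State} (hγ : IsGenOrbit (5 / 9) γ) :
    ∃ b ∈ Ioo (0 : ℝ) 1, omegaSet γ = {ptHL b} := by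
  obtain ⟨r, hr⟩ := hγ.exists_forall_eq_ptHL
  obtain ⟨y, hy⟩ := hγ.exists_mapClusterPt
  obtain ⟨b, hb, -, hbr⟩ := hr y hy
  refine ⟨b, hb, hγ.omegaSet_eq_singleton fun z hz => ?_⟩
  obtain ⟨c, hc, rfl, hcr⟩ := hr z hz
  rw [strictAntiOn_lineRatio.injOn hc hb (hcr.trans hbr.symm)]

end

end TiltedBianchiII

theorem theorem1 (w : ℝ) (hw_lower : -1 < w) (hw_upper : w < 1)
    (x : TiltedBianchiII.State) (hx : x ∈ TiltedBianchiII.sGen w) :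
    (∃ γ : ℝ → TiltedBianchiII.State, TiltedBianchiII.IsFutureOrbit w x γ) ∧
    ∀ γ : ℝ → TiltedBianchiII.State, TiltedBianchiII.IsFutureOrbit w x γ →
      (∀ τ : ℝ, 0 ≤ τ → γ τ ∈ TiltedBianchiII.sGen w) ∧
      (w ≤ -1 / 3 → TiltedBianchiII.omegaSet γ = {TiltedBianchiII.ptF}) ∧
      (-1 / 3 < w → w ≤ 3 / 7 →
        TiltedBianchiII.omegaSet γ = {TiltedBianchiII.ptCS w}) ∧
      (3 / 7 < w → w < 5 / 9 →
        TiltedBianchiII.omegaSet γ = {TiltedBianchiII.ptH w}) ∧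
      (w = 5 / 9 → ∃ b : ℝ, 0 < b ∧ b < 1 ∧
        TiltedBianchiII.omegaSet γ = {TiltedBianchiII.ptHL b}) ∧
      (5 / 9 < w → TiltedBianchiII.omegaSet γ = {TiltedBianchiII.ptHet}) := by
  refine ⟨TiltedBianchiII.exists_isFutureOrbit hw_lower hw_upper hx, fun γ hγ => ?_⟩
  have h : TiltedBianchiII.IsGenOrbit w γ := ⟨hw_lower, hw_upper, hγ.1 ▸ hx, hγ.2⟩
  refine ⟨fun τ hτ => h.mem_sGen hτ, h.omegaSet_eq_ptF, h.omegaSet_eq_ptCS, h.omegaSet_eq_ptH, ?_,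
    h.omegaSet_eq_ptHet⟩
  rintro rfl
  obtain ⟨b, hb, hω⟩ := h.exists_omegaSet_eq_ptHL
  exact ⟨b, hb.1, hb.2, hω⟩
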